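/- Points of $\mathbb{R}^2$ are written $(y,t)$. For an open set $\Omega\subset\mathbb{R}^2$ and $f\in W^{1,1}_{loc}(\Omega)$ let $\nabla^f=\partial_y+f\,\partial_t$, so that $\nabla^f f=\partial_y f+f\,\partial_t f$ (weak derivatives, defined up to null sets), and let $\mathscr{A}_f(E)=\int_E\sqrt{1+(\nabla^f f)^2}\,d\mathcal{L}^2$ for measurable $E\subset\Omega$. The function $f$ is *stationary* on $\Omega$ if $\frac{d}{d\epsilon}\mathscr{A}_{f+\epsilon\varphi}(\mathrm{spt}\,\varphi)|_{\epsilon=0}=0$ for every $\varphi\in C^\infty_c(\Omega)$. It is *$C^1$-intrinsic* if $f$ and $\nabla^f f$ are continuous on $\Omega$. It is a *weak Lagrangian solution of $\Delta^f f=0$* if through every $p\in\Omega$ there passes at least one integral curve of $\nabla^f$ along which $\nabla^f f$ (its continuous representative) is constant. Integral curves are absolutely continuous curves $\gamma$ with $\gamma'=(1,f(\gamma))$ almost everywhere. A *Lagrangian homeomorphism* associated with $\nabla^f$ on an open set $\omega$ where $f$ is continuous is a continuous injective map $\Psi:\tilde\omega\to\omega$, $\Psi(s,\tau)=(s,\chi(s,\tau))$,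 with $\tilde\omega\subset\mathbb{R}^2$ open, such that $\Psi(\tilde\omega)=\omega$, the map $\tau\mapsto\chi(s,\tau)$ is nondecreasing on $\{\tau:(s,\tau)\in\tilde\omega\}$ for each $s$, and for every $\tau$ and every interval $(s_1,s_2)$ with $(s_1,s_2)\times\{\tau\}\subset\tilde\omega$ the curve $s\mapsto\Psi(s,\tau)$ is an integral curve of $\nabla^f$ on $(s_1,s_2)$. A map is *locally biLipschitz* if it is injective and both it and its inverse, defined on its image, are locally Lipschitz. **Theorem.** Let $\Omega\subset\mathbb{R}^2$ be open and let $f$ be locally Lipschitz and stationary on $\Omega$. Then $\nabla^f f$ has a locally Lipschitz representative on $\Omega$ (denoted by $\nabla^f f$ from now on), and it is constant along every integral curve of $\nabla^f$ in $\Omega$. In particular $f$ is $C^1$-intrinsic and a weak Lagrangian solution of $\Delta^f f=0$ on $\Omega$. Moreover, let $\omega$ be open with $\overline\omega$ compact and contained in $\Omega$. Then there exists a locally biLipschitz Lagrangian homeomorphism $\Psi:\tilde\omega\to\omega$ associated with $\nabla^f$. For every such $\Psi(s,\tau)=(s,\chi(s,\tau))$, all $s_1,s_2,\tau_1,\tau_2\in[-\infty,+\infty]$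 with $(s_1,s_2)\times(\tau_1,\tau_2)\subset\tilde\omega$ and all $\hat s\in(s_1,s_2)$, there is a function $c:(\tau_1,\tau_2)\to\mathbb{R}$, locally biLipschitz onto its image, such that $$\chi(s,\tau)=a(\tau)\frac{(s-\hat s)^2}{2}+b(\tau)(s-\hat s)+c(\tau)\qquad\text{for all }(s,\tau)\in(s_1,s_2)\times(\tau_1,\tau_2),$$ where $a(\tau)=\nabla^f f(\hat s,c(\tau))$ and $b(\tau)=f(\hat s,c(\tau))$ are locally Lipschitz on $(\tau_1,\tau_2)$. Finally, up to a further change of variables one can take $c(\tau)=\tau$: there are an open interval $(\sigma_1,\sigma_2)$ and a locally biLipschitz map $\rho$ from $(\sigma_1,\sigma_2)$ onto $(\tau_1,\tau_2)$ with $c(\rho(\sigma))=\sigma$, such that $(s,\sigma)\mapsto(s,\chi(s,\rho(\sigma)))$ is a locally biLipschitz Lagrangian homeomorphism from $(s_1,s_2)\times(\sigma_1,\sigma_2)$ onto $\Psi((s_1,s_2)\times(\tau_1,\tau_2))$ associated with $\nabla^f$, and $$\chi(s,\rho(\sigma))=\nabla^f f(\hat s,\sigma)\frac{(s-\hat s)^2}{2}+f(\hat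 s,\sigma)(s-\hat s)+\sigma ,$$ where $\sigma\mapsto\nabla^f f(\hat s,\sigma)$ and $\sigma\mapsto f(\hat s,\sigma)$ are locally Lipschitz on $(\sigma_1,\sigma_2)$. -/

import Mathlib

open MeasureTheory Set
open scoped Topology ContDiff

noncomputable section

namespace IntrinsicGraph

/-- Smooth functions with compact support contained in `U`. -/
def IsTestFunction (U : Set (ℝ × ℝ)) (φ : ℝ × ℝ → ℝ) : Prop :=
  ContDiff ℝ ∞ φ ∧ HasCompactSupport φ ∧ tsupport φ ⊆ U

/-- `u` and `w` are locally integrable on `U` and `w` is the weak (distributional) derivative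
of `u` on `U` in the direction `v`. -/
def HasWeakDeriv (U : Set (ℝ × ℝ)) (v : ℝ × ℝ) (u w : ℝ × ℝ → ℝ) : Prop :=
  LocallyIntegrableOn u U ∧ LocallyIntegrableOn w U ∧
    ∀ φ : ℝ × ℝ → ℝ, IsTestFunction U φ →
      ∫ p in U, u p * fderiv ℝ φ p v = - ∫ p in U, w p * φ p

/-- `f` is in `W^{1,1}_loc(U)`, and `g` is a representative of its intrinsic gradient
`∇^f f = ∂_y f + f ∂_t f`; points of the plane are written `(y, t)`. -/
def IsIntrinsicGradient (U : Set (ℝ × ℝ)) (f g : ℝ × ℝ → ℝ) : Prop :=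
  ∃ fy ft : ℝ × ℝ → ℝ, HasWeakDeriv U (1, 0) f fy ∧ HasWeakDeriv U (0, 1) f ft ∧
    g =ᵐ[volume.restrict U] fun p => fy p + f p * ft p

open Classical in
/-- A choice of a representative of `∇^f f` on `U`; two choices agree almost everywhere on `U`.
(The value is `0` if `f` is not in `W^{1,1}_loc(U)`.) -/
def intrinsicGradient (U : Set (ℝ × ℝ)) (f : ℝ × ℝ → ℝ) : ℝ × ℝ → ℝ :=
  if h : ∃ g, IsIntrinsicGradient U f g then h.choose else 0

/-- The graph area functional `𝒜_f(E) = ∫_E √(1 + (∇^f f)²)`, for `E ⊆ U`. -/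
def graphArea (U : Set (ℝ × ℝ)) (f : ℝ × ℝ → ℝ) (E : Set (ℝ × ℝ)) : ℝ :=
  ∫ p in E, √(1 + intrinsicGradient U f p ^ 2)

/-- The first variation of the area functional vanishes: for every test function `φ`, the
derivative of `ε ↦ 𝒜_{f + ε φ}(spt φ)` at `ε = 0` exists and is zero. -/
def IsStationaryGraph (U : Set (ℝ × ℝ)) (f : ℝ × ℝ → ℝ) : Prop :=
  ∀ φ : ℝ × ℝ → ℝ, IsTestFunction U φ →
    HasDerivAt (fun ε : ℝ => graphArea U (fun p => f p + ε * φ p) (tsupport φ)) 0 0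

/-- `f` is `C¹`-intrinsic on `U`: `f` and `∇^f f` are continuous on `U`. -/
def IsC1Intrinsic (U : Set (ℝ × ℝ)) (f : ℝ × ℝ → ℝ) : Prop :=
  ContinuousOn f U ∧ ∃ g, IsIntrinsicGradient U f g ∧ ContinuousOn g U

/-- On the interval `I`, the curve `γ` is (locally) absolutely continuous and an integral curve of
`∇^f = ∂_y + f ∂_t`, that is, `γ' = (1, f(γ))` almost everywhere. -/
def IsNablaCurve (f : ℝ × ℝ → ℝ) (γ : ℝ → ℝ × ℝ) (I : Set ℝ) : Prop :=
  (∀ a b : ℝ, a ≤ b → Icc a b ⊆ I → AbsolutelyContinuousOnInterval γ a b) ∧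
    ∀ᵐ s ∂(volume.restrict I), HasDerivAt γ ((1 : ℝ), f (γ s)) s

/-- `f` is a weak Lagrangian solution of `Δ^f f = 0` on `U`: the continuous representative of
`∇^f f` is constant along at least one integral curve of `∇^f` through each point of `U`. -/
def IsWeakLagrangianSolution (U : Set (ℝ × ℝ)) (f : ℝ × ℝ → ℝ) : Prop :=
  ∃ g : ℝ × ℝ → ℝ, IsIntrinsicGradient U f g ∧ ContinuousOn g U ∧
    ∀ p ∈ U, ∃ (γ : ℝ → ℝ × ℝ) (s₁ s₂ : ℝ), (∀ s ∈ Ioo s₁ s₂, γ s ∈ U) ∧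
      IsNablaCurve f γ (Ioo s₁ s₂) ∧ (∃ s₀ ∈ Ioo s₁ s₂, γ s₀ = p) ∧
      ∀ s ∈ Ioo s₁ s₂, g (γ s) = g p

/-- The map `Ψ(s, τ) = (s, χ(s, τ))`. -/
def lagrangianMap (χ : ℝ × ℝ → ℝ) : ℝ × ℝ → ℝ × ℝ := fun p => (p.1, χ p)

/-- `Ψ(s, τ) = (s, χ(s, τ))` is a Lagrangian parameterization `V → U` associated with the vector
field `∇^f`. -/
structure IsLagrangianParam (f : ℝ × ℝ → ℝ) (V U : Set (ℝ × ℝ)) (χ : ℝ × ℝ → ℝ) : Prop where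
  isOpen_target : IsOpen U
  continuousOn_field : ContinuousOn f U
  isOpen_source : IsOpen V
  continuousOn : ContinuousOn χ V
  image_eq : lagrangianMap χ '' V = U
  mono : ∀ s τ τ' : ℝ, (s, τ) ∈ V → (s, τ') ∈ V → τ ≤ τ' → χ (s, τ) ≤ χ (s, τ')
  integralCurve : ∀ τ s₁ s₂ : ℝ, (∀ s ∈ Ioo s₁ s₂, (s, τ) ∈ V) →
    IsNablaCurve f (fun s => lagrangianMap χ (s, τ)) (Ioo s₁ s₂)

/-- `F` is locally Lipschitz and injective on `s`, with locally Lipschitz inverse `F(s) → s`. -/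
def LocallyBiLipschitzOn {X Y : Type*} [PseudoEMetricSpace X] [PseudoEMetricSpace Y]
    (s : Set X) (F : X → Y) : Prop :=
  LocallyLipschitzOn s F ∧ ∃ G : Y → X, LeftInvOn G F s ∧ LocallyLipschitzOn (F '' s) G

/-- `Ψ(s, τ) = (s, χ(s, τ))` is a locally biLipschitz Lagrangian homeomorphism `V → U` associated
with `∇^f`. -/
def IsLagrangianHomeo (f : ℝ × ℝ → ℝ) (V U : Set (ℝ × ℝ)) (χ : ℝ × ℝ → ℝ) : Prop :=
  IsLagrangianParam f V U χ ∧ LocallyBiLipschitzOn V (lagrangianMap χ)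

/-- The open interval of reals with possibly infinite endpoints. -/
def openInterval (a b : EReal) : Set ℝ := {x | a < (x : EReal) ∧ (x : EReal) < b}

end IntrinsicGraph

end

open IntrinsicGraph

/-!
The plane is written in coordinates `(y, t)`; `f` is locally Lipschitz and stationary.

Along an integral curve `s ↦ (s, x s)` of `∇^f` one has `x' = f (s, x)`, so it suffices to show that
`f` is *affine* along every integral curve: then `x` is quadratic, and the slope of `f` is a
representative of `∇^f f` that is constant along the curve. It is locally Lipschitz, because the
slope is a difference quotient of `f` between two fixed times and the flow is locally Lipschitz in
its starting point.

The affinity is a local matter, so `f` may be replaced by a bounded Lipschitz function `F` on the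
whole plane, whose flow gives biLipschitz coordinates `Ψ (s, τ) = (s, χ (s, τ))`. With
`A x = x / √(1 + x²)`, the first variation of the area is
`∫ A (∇^F F) (∇^F φ + φ ∂_t F) = 0`, first for smooth `φ` (`IsStationaryGraph.integral_eq_zero`) and
then, by mollification, for Lipschitz `φ` (`integral_eq_zero_of_lipschitz`). In the coordinates `Ψ`
one has `∇^F φ = ∂_s (φ ∘ Ψ)` and `∂_t F · ∂_τ χ = ∂_s ∂_τ χ`, so the choice
`φ ∘ Ψ = θ / ∂_τ χ` turns the equation into `∫ A (∇^F F ∘ Ψ) ∂_s θ = 0`. This `φ` is not Lipschitz;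
replacing `∂_τ χ` by difference quotients and passing to the limit gives
`IsFlow.integral_areaSlope_mul_deriv_eq_zero`.

Now let `b = F ∘ Ψ`, so that `∂_s b = ∇^F F ∘ Ψ`, let `ℓ` be the affine interpolation of `b` in `s`
between two times, with slope `k τ`, and take `θ = (b - ℓ) ζ (τ)` with a cutoff `ζ ≥ 0`. Since
`∫ A (k τ) ∂_s θ = 0` as well, `∫ (A (∂_s b) - A (k τ)) (∂_s b - k τ) ζ = 0`, and `A` is strictly
increasing; hence `∂_s θ = 0` and `b = ℓ` (`IsFlow.comp_flowMap_eq_affine`).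

The statements about Lagrangian homeomorphisms follow: the flow of a Lipschitz extension of `f` is
one (`exists_isLagrangianHomeo`), the curves of any other one are integral curves and therefore
parabolas (`IsStationaryGraph.lagrangian_eq`), and its inverse restricted to a vertical line is the
change of variables `ρ` (`IsLagrangianHomeo.relabel`).
-/

namespace IntrinsicGraph

open Filter
open scoped NNReal Convolution

/-! ### Locally Lipschitz functions -/

theorem _root_.LocallyLipschitz.mul_real {X : Type*} [PseudoEMetricSpace X] {u v : X → ℝ}
    (hu : LocallyLipschitz u) (hv : LocallyLipschitz v) :
    LocallyLipschitz fun x => u x * v x :=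
  (ContDiff.locallyLipschitz (𝕂 := ℝ) (f := fun q : ℝ × ℝ => q.1 * q.2) (by fun_prop)).comp
    (hu.prodMk hv)

theorem _root_.LocallyLipschitz.div_real {X : Type*} [PseudoEMetricSpace X] {u v : X → ℝ}
    (hu : LocallyLipschitz u) (hv : LocallyLipschitz v) (h0 : ∀ x, v x ≠ 0) :
    LocallyLipschitz fun x => u x / v x := by
  have hinv : LocallyLipschitz fun x => (v x)⁻¹ := by
    intro x
    obtain ⟨K, t, ht, hK⟩ :=
      (contDiffAt_inv ℝ (h0 x) (n := 1)).exists_lipschitzOnWith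
    obtain ⟨C, w, hw, hC⟩ := hv x
    refine ⟨K * C, w ∩ v ⁻¹' t, inter_mem hw (hv.continuous.continuousAt ht), ?_⟩
    exact hK.comp (hC.mono inter_subset_left) (fun y hy => hy.2)
  simpa only [div_eq_mul_inv] using hu.mul_real hinv

theorem _root_.LocallyLipschitzOn.comp_of_mapsTo {X Y Z : Type*} [PseudoEMetricSpace X]
    [PseudoEMetricSpace Y] [PseudoEMetricSpace Z] {v : Y → Z} {u : X → Y} {s : Set X} {t : Set Y}
    (hv : LocallyLipschitzOn t v) (hu : LocallyLipschitzOn s u) (h : MapsTo u s t) :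
    LocallyLipschitzOn s (fun x => v (u x)) := by
  intro x hx
  obtain ⟨C, w, hw, hC⟩ := hu hx
  obtain ⟨K, z, hz, hK⟩ := hv (h hx)
  refine ⟨K * C, w ∩ u ⁻¹' z, inter_mem hw ?_, ?_⟩
  · exact ((hu.continuousOn x hx).tendsto_nhdsWithin h) hz
  · exact hK.comp (hC.mono inter_subset_left) (fun y hy => hy.2)

theorem _root_.LocallyLipschitzOn.prodMk {X Y Z : Type*} [PseudoEMetricSpace X]
    [PseudoEMetricSpace Y] [PseudoEMetricSpace Z] {u : X → Y} {v : X → Z} {s : Set X}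
    (hu : LocallyLipschitzOn s u) (hv : LocallyLipschitzOn s v) :
    LocallyLipschitzOn s (fun x => (u x, v x)) := by
  intro x hx
  obtain ⟨C, w, hw, hC⟩ := hu hx
  obtain ⟨K, z, hz, hK⟩ := hv hx
  exact ⟨max C K, w ∩ z, inter_mem hw hz,
    (hC.mono inter_subset_left).prodMk (hK.mono inter_subset_right)⟩

/-- A locally Lipschitz function on an open set agrees near a compact subset with a bounded
Lipschitz function on the whole plane. -/
theorem exists_lipschitz_extension {Ω K : Set (ℝ × ℝ)} {f : ℝ × ℝ → ℝ} (hΩ : IsOpen Ω)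
    (hf : LocallyLipschitzOn Ω f) (hK : IsCompact K) (hKΩ : K ⊆ Ω) :
    ∃ (F : ℝ × ℝ → ℝ) (L : ℝ≥0) (M : ℝ) (W : Set (ℝ × ℝ)), LipschitzWith L F ∧
      (∀ p, |F p| ≤ M) ∧ IsOpen W ∧ K ⊆ W ∧ W ⊆ Ω ∧ EqOn F f W := by
  obtain ⟨K', hK', hKK', hK'Ω⟩ := exists_compact_between hK hΩ hKΩ
  obtain ⟨L, hL⟩ := (hf.mono hK'Ω).exists_lipschitzOnWith_of_compact hK'
  obtain ⟨F, hF, hFf⟩ := hL.extend_real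
  obtain ⟨M, hM⟩ := hK'.exists_bound_of_continuousOn hL.continuousOn
  refine ⟨fun p => max (-|M|) (min (F p) |M|), L, |M|, interior K', ?_, ?_, isOpen_interior, hKK',
    interior_subset.trans hK'Ω, ?_⟩
  · exact (hF.min_const |M|).const_max _
  · intro p
    rw [abs_le]
    exact ⟨le_max_left _ _, max_le (by linarith [abs_nonneg M]) (min_le_right _ _)⟩
  · intro p hp
    have h1 := hM p (interior_subset hp)
    have h2 := hFf (interior_subset hp)
    rw [Real.norm_eq_abs] at h1
    have h3 := abs_le.1 (h1.trans (le_abs_self M))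
    simp only
    rw [← h2, min_eq_left h3.2, max_eq_right h3.1]

theorem _root_.LocallyLipschitz.exists_lipschitzWith_of_hasCompactSupport {u : ℝ × ℝ → ℝ}
    (hu : LocallyLipschitz u) (hc : HasCompactSupport u) : ∃ C, LipschitzWith C u := by
  obtain ⟨R, hR⟩ := hc.isBounded.subset_closedBall (0 : ℝ × ℝ)
  obtain ⟨C, hC⟩ := (hu.locallyLipschitzOn
    (s := Metric.closedBall (0 : ℝ × ℝ) (R + 1))).exists_lipschitzOnWith_of_compact
    (isCompact_closedBall _ _)
  obtain ⟨M, hM⟩ := hc.exists_bound_of_continuous hu.continuous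
  have h0 : ∀ x, x ∉ Metric.closedBall (0 : ℝ × ℝ) R → u x = 0 := fun x hx =>
    image_eq_zero_of_notMem_tsupport fun h => hx (hR h)
  have hM0 : 0 ≤ M := (norm_nonneg _).trans (hM 0)
  -- points on both sides of the collar `R < |x| ≤ R + 1` are at distance at least `1`
  have key : ∀ x y, x ∈ Metric.closedBall (0 : ℝ × ℝ) R → dist (u x) (u y) ≤
      max (C : ℝ) M * dist x y := by
    intro x y hx
    rcases le_or_gt (dist y 0) (R + 1) with hy | hy
    · refine (hC.dist_le_mul x ?_ y hy).trans ?_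
      · exact Metric.closedBall_subset_closedBall (by linarith) hx
      · gcongr; exact le_max_left _ _
    · rw [h0 y (by simp only [Metric.mem_closedBall, not_le]; linarith), dist_zero_right]
      have h1 : 1 ≤ dist x y := by
        have := dist_triangle y x 0
        rw [dist_comm y x] at this
        have := Metric.mem_closedBall.1 hx
        linarith
      calc ‖u x‖ ≤ M := hM x
        _ ≤ max (C : ℝ) M * 1 := by rw [mul_one]; exact le_max_right _ _
        _ ≤ _ := by gcongr
  refine ⟨Real.toNNReal (max (C : ℝ) M), LipschitzWith.of_dist_le_mul fun x y => ?_⟩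
  rw [Real.coe_toNNReal _ (hM0.trans (le_max_right _ _))]
  by_cases hx : x ∈ Metric.closedBall (0 : ℝ × ℝ) R
  · exact key x y hx
  by_cases hy : y ∈ Metric.closedBall (0 : ℝ × ℝ) R
  · rw [dist_comm, dist_comm x y]; exact key y x hy
  · rw [h0 x hx, h0 y hy, dist_self]
    have := hM0.trans (le_max_right (C : ℝ) M)
    positivity

/-- Rademacher's theorem for locally Lipschitz functions. -/
theorem _root_.LocallyLipschitzOn.ae_differentiableAt {Ω : Set (ℝ × ℝ)} {f : ℝ × ℝ → ℝ}
    (hΩ : IsOpen Ω) (hf : LocallyLipschitzOn Ω f) :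
    ∀ᵐ p : ℝ × ℝ, p ∈ Ω → DifferentiableAt ℝ f p := by
  have : volume {p | ¬ (p ∈ Ω → DifferentiableAt ℝ f p)} = 0 := by
    refine measure_null_of_locally_null _ fun p hp => ?_
    simp only [Classical.not_imp, mem_ofPred_eq] at hp
    obtain ⟨C, t, ht, hC⟩ := hf hp.1
    rw [hΩ.nhdsWithin_eq hp.1] at ht
    obtain ⟨w, hwt, hw, hpw⟩ := mem_nhds_iff.1 ht
    refine ⟨w ∩ {p | ¬ (p ∈ Ω → DifferentiableAt ℝ f p)},
      inter_mem (nhdsWithin_le_nhds (hw.mem_nhds hpw)) self_mem_nhdsWithin, ?_⟩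
    have h1 := (hC.mono hwt).ae_differentiableWithinAt_of_mem (μ := volume)
    refine measure_mono_null ?_ (ae_iff.1 h1)
    intro q hq hq'
    apply hq.2
    intro _
    exact (hq' hq.1).differentiableAt (hw.mem_nhds hq.1)
  exact ae_iff.2 this

theorem _root_.LocallyLipschitz.ae_differentiableAt {f : ℝ × ℝ → ℝ} (hf : LocallyLipschitz f) :
    ∀ᵐ p : ℝ × ℝ, DifferentiableAt ℝ f p := by
  filter_upwards [(hf.locallyLipschitzOn (s := univ)).ae_differentiableAt isOpen_univ] with p hp
  exact hp (mem_univ p)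

/-- Locally Lipschitz maps of the plane send null sets to null sets. -/
theorem _root_.LocallyLipschitz.volume_image_eq_zero {Φ : ℝ × ℝ → ℝ × ℝ}
    (hΦ : LocallyLipschitz Φ) {N : Set (ℝ × ℝ)} (hN : volume N = 0) : volume (Φ '' N) = 0 := by
  have h1 : Φ '' N ⊆ ⋃ n : ℕ, Φ '' (N ∩ Metric.closedBall 0 n) := by
    rintro _ ⟨p, hp, rfl⟩
    obtain ⟨n, hn⟩ := exists_nat_ge (dist p 0)
    exact mem_iUnion.2 ⟨n, p, ⟨hp, hn⟩, rfl⟩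
  refine measure_mono_null h1 (measure_iUnion_null fun n => ?_)
  obtain ⟨C, hC⟩ := (hΦ.locallyLipschitzOn
    (s := Metric.closedBall (0 : ℝ × ℝ) n)).exists_lipschitzOnWith_of_compact
    (isCompact_closedBall _ _)
  have h2 := (hC.mono (inter_subset_right (s := N))).hausdorffMeasure_image_le
    (d := 2) (by norm_num)
  rw [hausdorffMeasure_prod_real] at h2
  rw [measure_mono_null inter_subset_left hN, mul_zero] at h2
  exact le_antisymm h2 bot_le

theorem integral_lineDeriv_eq_zero {u : ℝ × ℝ → ℝ} {C : ℝ≥0} (hu : LipschitzWith C u)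
    (hc : HasCompactSupport u) (v : ℝ × ℝ) : ∫ p, lineDeriv ℝ u p v = 0 := by
  have h := LipschitzWith.integral_lineDeriv_mul_eq (μ := (volume : Measure (ℝ × ℝ)))
    (LipschitzWith.const (1 : ℝ)) hu hc (-v)
  simpa [lineDeriv] using h.symm

/-- A compactly supported Lipschitz function whose derivative in the direction `(1, 0)` vanishes
almost everywhere is zero. -/
theorem eq_zero_of_lineDeriv_ae_eq_zero {u : ℝ × ℝ → ℝ} {C : ℝ≥0} (hu : LipschitzWith C u)
    (hc : HasCompactSupport u) (h0 : ∀ᵐ p : ℝ × ℝ, HasLineDerivAt ℝ u 0 p (1, 0)) (p : ℝ × ℝ) :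
    u p = 0 := by
  have hc2 : HasCompactSupport fun p => u p * u p := hc.mul_right
  obtain ⟨D, hD⟩ := (hu.locallyLipschitz.mul_real
    hu.locallyLipschitz).exists_lipschitzWith_of_hasCompactSupport hc2
  -- integrate `u ^ 2` by parts against the first coordinate
  have h := LipschitzWith.integral_lineDeriv_mul_eq (μ := (volume : Measure (ℝ × ℝ)))
    (LipschitzWith.prod_fst (α := ℝ) (β := ℝ)) hD hc2 (1, 0)
  have h1 : ∀ x : ℝ × ℝ, lineDeriv ℝ (Prod.fst : ℝ × ℝ → ℝ) x (1, 0) = 1 := by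
    intro x
    simp [lineDeriv]
  have h2 : ∫ x : ℝ × ℝ, lineDeriv ℝ (fun p => u p * u p) x (-(1, 0)) * x.1 = 0 := by
    refine (integral_congr_ae ?_).trans (integral_zero (ℝ × ℝ) ℝ)
    filter_upwards [h0] with x hx
    have h3 : HasLineDerivAt ℝ (fun p => u p * u p) 0 x (1, 0) := by
      have := HasDerivAt.mul hx hx
      simp only [zero_mul, mul_zero, add_zero] at this
      exact this
    have h4 : HasLineDerivAt ℝ (fun p => u p * u p) 0 x (-(1, 0)) := by
      have := h3.smul (-1)
      simpa using this
    rw [h4.lineDeriv, zero_mul]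
  rw [h2] at h
  simp only [h1, one_mul] at h
  rw [integral_eq_zero_iff_of_nonneg (fun x => mul_self_nonneg _)
    (hD.continuous.integrable_of_hasCompactSupport hc2)] at h
  have h5 := (hD.continuous.ae_eq_iff_eq (μ := volume) continuous_const).1 h
  exact mul_self_eq_zero.1 (congrFun h5 p)

/-! ### Weak derivatives of locally Lipschitz functions -/

theorem abs_fderiv_apply_le {u : ℝ × ℝ → ℝ} {C : ℝ≥0} (hu : LipschitzWith C u) (p v : ℝ × ℝ) :
    |fderiv ℝ u p v| ≤ C * ‖v‖ :=
  (ContinuousLinearMap.le_opNorm _ _).trans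
    (mul_le_mul_of_nonneg_right (norm_fderiv_le_of_lipschitz ℝ hu) (norm_nonneg _))

theorem norm_one_prod_le {x M : ℝ} (h : |x| ≤ M) : ‖((1 : ℝ), x)‖ ≤ 1 + M := by
  rw [Prod.norm_def, norm_one, Real.norm_eq_abs]
  exact max_le (by linarith [abs_nonneg x]) (by linarith)

theorem hasWeakDeriv_fderiv {Ω : Set (ℝ × ℝ)} {f : ℝ × ℝ → ℝ} (hΩ : IsOpen Ω)
    (hf : LocallyLipschitzOn Ω f) (v : ℝ × ℝ) :
    HasWeakDeriv Ω v f fun p => fderiv ℝ f p v := by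
  refine ⟨hf.continuousOn.locallyIntegrableOn hΩ.measurableSet, fun p hp => ?_, fun φ hφ => ?_⟩
  · obtain ⟨C, t, ht, hC⟩ := hf hp
    rw [hΩ.nhdsWithin_eq hp] at ht
    obtain ⟨w, hwt, hw, hpw⟩ := mem_nhds_iff.1 ht
    refine ⟨w ∩ Metric.ball p 1,
      nhdsWithin_le_nhds (inter_mem (hw.mem_nhds hpw) (Metric.ball_mem_nhds p one_pos)), ?_⟩
    refine Measure.integrableOn_of_bounded (M := C * ‖v‖)
      (measure_mono inter_subset_right |>.trans_lt measure_ball_lt_top).ne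
      (measurable_fderiv_apply_const ℝ f v).aestronglyMeasurable ?_
    refine ae_restrict_of_forall_mem (hw.inter Metric.isOpen_ball).measurableSet fun q hq => ?_
    exact (ContinuousLinearMap.le_opNorm _ _).trans (mul_le_mul_of_nonneg_right
      (norm_fderiv_le_of_lipschitzOn ℝ (hw.mem_nhds hq.1) (hC.mono hwt)) (norm_nonneg _))
  · obtain ⟨hφs, hφc, hφΩ⟩ := hφ
    obtain ⟨F, L, M, W, hF, -, hW, hKW, -, hFf⟩ := exists_lipschitz_extension hΩ hf hφc hφΩ
    obtain ⟨D, hD⟩ := (hφs.of_le (by simp) : ContDiff ℝ 1 φ).lipschitzWith_of_hasCompactSupport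
      hφc one_ne_zero
    have h0 : ∀ p, p ∉ tsupport φ → φ p = 0 := fun p hp => image_eq_zero_of_notMem_tsupport hp
    have h0' : ∀ p, p ∉ tsupport φ → fderiv ℝ φ p = 0 := fun p hp =>
      image_eq_zero_of_notMem_tsupport fun h => hp (tsupport_fderiv_subset ℝ h)
    have hdφ : ∀ p, fderiv ℝ φ p v = lineDeriv ℝ φ p v := fun p =>
      ((hφs.differentiable (by simp)) p).lineDeriv_eq_fderiv.symm
    rw [setIntegral_eq_integral_of_forall_compl_eq_zero
        (fun p hp => by rw [h0' p fun h => hp (hφΩ h)]; simp),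
      setIntegral_eq_integral_of_forall_compl_eq_zero
        (fun p hp => by rw [h0 p fun h => hp (hφΩ h), mul_zero])]
    have key := LipschitzWith.integral_lineDeriv_mul_eq (μ := (volume : Measure (ℝ × ℝ)))
      hF hD hφc v
    have e1 : ∫ p, f p * fderiv ℝ φ p v = - ∫ p, lineDeriv ℝ φ p (-v) * F p := by
      rw [← integral_neg]
      congr 1
      ext p
      by_cases hp : p ∈ tsupport φ
      · rw [lineDeriv_neg, ← hdφ, hFf (hKW hp)]; ring
      · rw [lineDeriv_neg, ← hdφ, h0' p hp]; simp
    rw [e1, ← key]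
    congr 1
    apply integral_congr_ae
    filter_upwards [hF.ae_differentiableAt] with p hp
    by_cases hpK : p ∈ tsupport φ
    · have : F =ᶠ[𝓝 p] f := hFf.eventuallyEq_of_mem (hW.mem_nhds (hKW hpK))
      rw [hp.lineDeriv_eq_fderiv, this.fderiv_eq]
    · rw [h0 p hpK]; simp

theorem HasWeakDeriv.ae_eq {Ω : Set (ℝ × ℝ)} {v : ℝ × ℝ} {f w₁ w₂ : ℝ × ℝ → ℝ} (hΩ : IsOpen Ω)
    (h₁ : HasWeakDeriv Ω v f w₁) (h₂ : HasWeakDeriv Ω v f w₂) :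
    w₁ =ᵐ[volume.restrict Ω] w₂ := by
  rw [Filter.EventuallyEq, ae_restrict_iff' hΩ.measurableSet]
  have key := hΩ.ae_eq_zero_of_integral_contDiff_smul_eq_zero (μ := (volume : Measure (ℝ × ℝ)))
    (h₁.2.1.sub h₂.2.1) (fun φ hφ hφc hφΩ => ?_)
  · filter_upwards [key] with p hp hpΩ
    exact sub_eq_zero.1 (hp hpΩ)
  have hi : ∀ w : ℝ × ℝ → ℝ, LocallyIntegrableOn w Ω → IntegrableOn (fun p => w p * φ p) Ω := by
    intro w hw
    have h1 : IntegrableOn (fun p => w p * φ p) (tsupport φ) :=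
      (hw.integrableOn_compact_subset hφΩ hφc).mul_continuousOn hφ.continuous.continuousOn hφc
    refine (integrableOn_iff_integrable_of_support_subset ?_).1 h1 |>.integrableOn
    exact (Function.support_mul_subset_right _ _).trans subset_closure
  have e1 := h₁.2.2 φ ⟨hφ, hφc, hφΩ⟩
  have e2 := h₂.2.2 φ ⟨hφ, hφc, hφΩ⟩
  have e3 : ∫ p in Ω, w₁ p * φ p - w₂ p * φ p = 0 := by
    rw [integral_sub (hi _ h₁.2.1) (hi _ h₂.2.1)]
    linarith
  rw [← e3, setIntegral_eq_integral_of_forall_compl_eq_zero]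
  · congr 1; ext p; simp only [Pi.sub_apply, smul_eq_mul]; ring
  · intro p hp
    rw [image_eq_zero_of_notMem_tsupport fun h => hp (hφΩ h)]; simp

theorem IsIntrinsicGradient.ae_eq {Ω : Set (ℝ × ℝ)} {f g₁ g₂ : ℝ × ℝ → ℝ} (hΩ : IsOpen Ω)
    (h₁ : IsIntrinsicGradient Ω f g₁) (h₂ : IsIntrinsicGradient Ω f g₂) :
    g₁ =ᵐ[volume.restrict Ω] g₂ := by
  obtain ⟨a, b, ha, hb, hg⟩ := h₁
  obtain ⟨a', b', ha', hb', hg'⟩ := h₂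
  filter_upwards [hg, hg', ha.ae_eq hΩ ha', hb.ae_eq hΩ hb'] with p e1 e2 e3 e4
  rw [e1, e2, e3, e4]

/-- The pointwise intrinsic gradient: the derivative of `f` at `p` in the direction `(1, f p)`. -/
noncomputable def nabla (f : ℝ × ℝ → ℝ) (p : ℝ × ℝ) : ℝ := fderiv ℝ f p (1, f p)

theorem nabla_eq (f : ℝ × ℝ → ℝ) (p : ℝ × ℝ) :
    nabla f p = fderiv ℝ f p (1, 0) + f p * fderiv ℝ f p (0, 1) := by
  have : ((1 : ℝ), f p) = (1, 0) + f p • ((0 : ℝ), (1 : ℝ)) := by simp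
  rw [nabla, this, map_add, map_smul, smul_eq_mul]

theorem isIntrinsicGradient_nabla {Ω : Set (ℝ × ℝ)} {f : ℝ × ℝ → ℝ} (hΩ : IsOpen Ω)
    (hf : LocallyLipschitzOn Ω f) : IsIntrinsicGradient Ω f (nabla f) :=
  ⟨_, _, hasWeakDeriv_fderiv hΩ hf _, hasWeakDeriv_fderiv hΩ hf _,
    Eventually.of_forall fun p => nabla_eq f p⟩

theorem intrinsicGradient_ae_eq {Ω : Set (ℝ × ℝ)} {f : ℝ × ℝ → ℝ} (hΩ : IsOpen Ω)
    (hf : LocallyLipschitzOn Ω f) : intrinsicGradient Ω f =ᵐ[volume.restrict Ω] nabla f := by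
  have h : ∃ g, IsIntrinsicGradient Ω f g := ⟨_, isIntrinsicGradient_nabla hΩ hf⟩
  have : intrinsicGradient Ω f = h.choose := by rw [intrinsicGradient, dif_pos h]
  rw [this]
  exact h.choose_spec.ae_eq hΩ (isIntrinsicGradient_nabla hΩ hf)

theorem measurable_fderiv_apply {u c : ℝ × ℝ → ℝ} (hc : Continuous c) :
    Measurable fun p => fderiv ℝ u p (1, c p) := by
  have : (fun p => fderiv ℝ u p (1, c p)) =
      fun p => fderiv ℝ u p (1, 0) + c p * fderiv ℝ u p (0, 1) := by
    ext p
    have : ((1 : ℝ), c p) = (1, 0) + c p • ((0 : ℝ), (1 : ℝ)) := by simp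
    rw [this, map_add, map_smul, smul_eq_mul]
  rw [this]
  exact (measurable_fderiv_apply_const ℝ u _).add
    (hc.measurable.mul (measurable_fderiv_apply_const ℝ u _))

theorem abs_nabla_le {F : ℝ × ℝ → ℝ} {L : ℝ≥0} {M : ℝ} (hF : LipschitzWith L F)
    (hM : ∀ p, |F p| ≤ M) (p : ℝ × ℝ) : |nabla F p| ≤ L * (1 + M) :=
  (abs_fderiv_apply_le hF p _).trans
    (mul_le_mul_of_nonneg_left (norm_one_prod_le (hM p)) L.coe_nonneg)

/-! ### The first variation of the area -/

/-- The derivative of the area integrand `x ↦ √(1 + x²)`. -/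
noncomputable def areaSlope (x : ℝ) : ℝ := x / √(1 + x ^ 2)

theorem hasDerivAt_sqrt_one_add_sq (x : ℝ) :
    HasDerivAt (fun x : ℝ => √(1 + x ^ 2)) (areaSlope x) x := by
  have h : (1 + x ^ 2) ≠ 0 := by positivity
  convert! ((hasDerivAt_pow 2 x).const_add 1).sqrt h using 1
  rw [areaSlope]
  field_simp
  norm_num [mul_comm]

theorem abs_areaSlope_le (x : ℝ) : |areaSlope x| ≤ 1 := by
  rw [areaSlope, abs_div, abs_of_nonneg (Real.sqrt_nonneg _), div_le_one (by positivity)]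
  exact Real.abs_le_sqrt (by linarith)

theorem lipschitzWith_sqrt_one_add_sq : LipschitzWith 1 fun x : ℝ => √(1 + x ^ 2) := by
  refine lipschitzWith_of_nnnorm_deriv_le (fun x => (hasDerivAt_sqrt_one_add_sq x).differentiableAt)
    fun x => ?_
  rw [(hasDerivAt_sqrt_one_add_sq x).deriv, ← NNReal.coe_le_coe]
  simpa using abs_areaSlope_le x

theorem continuous_areaSlope : Continuous areaSlope := by
  unfold areaSlope
  exact continuous_id.div (by fun_prop) fun x => by positivity

theorem contDiff_areaSlope : ContDiff ℝ 1 areaSlope := by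
  unfold areaSlope
  refine contDiff_id.div ((by fun_prop : ContDiff ℝ 1 fun x : ℝ => 1 + x ^ 2).sqrt
    fun x => by positivity) fun x => by positivity

theorem areaSlope_strictMono : StrictMono areaSlope := by
  intro x y hxy
  -- `areaSlope` is the tangent-to-sine map, whose derivative is `(1 + x²)^(-3/2)`
  have hd : ∀ x, HasDerivAt areaSlope ((√(1 + x ^ 2) * (1 + x ^ 2))⁻¹) x := by
    intro x
    have h0 : √(1 + x ^ 2) ≠ 0 := by positivity
    have h1 : √(1 + x ^ 2) ^ 2 = 1 + x ^ 2 := Real.sq_sqrt (by positivity)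
    have := (hasDerivAt_id x).div (hasDerivAt_sqrt_one_add_sq x) h0
    convert! this using 1
    rw [areaSlope, h1, id]
    field_simp
    rw [h1]; ring
  exact strictMono_of_hasDerivAt_pos hd (fun x => by positivity) hxy

/-- The linear part in `φ` of the intrinsic gradient of `F + φ`. -/
noncomputable def linearVariation (F φ : ℝ × ℝ → ℝ) (p : ℝ × ℝ) : ℝ :=
  fderiv ℝ φ p (1, F p) + φ p * fderiv ℝ F p (0, 1)

theorem abs_linearVariation_le {F φ : ℝ × ℝ → ℝ} {L C : ℝ≥0} {M B : ℝ} (hF : LipschitzWith L F)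
    (hM : ∀ p, |F p| ≤ M) (hφ : LipschitzWith C φ) (hB : ∀ p, |φ p| ≤ B) (p : ℝ × ℝ) :
    |linearVariation F φ p| ≤ C * (1 + M) + B * L := by
  have h1 : |fderiv ℝ φ p (1, F p)| ≤ C * (1 + M) := (abs_fderiv_apply_le hφ p _).trans
    (mul_le_mul_of_nonneg_left (norm_one_prod_le (hM p)) C.coe_nonneg)
  have h2 : |fderiv ℝ F p (0, 1)| ≤ L := by
    simpa [Prod.norm_def] using abs_fderiv_apply_le hF p (0, 1)
  have h3 : |φ p * fderiv ℝ F p (0, 1)| ≤ B * L := by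
    rw [abs_mul]
    exact mul_le_mul (hB p) h2 (abs_nonneg _) ((abs_nonneg _).trans (hB p))
  exact (abs_add_le _ _).trans (add_le_add h1 h3)

theorem measurable_linearVariation {F φ : ℝ × ℝ → ℝ} (hF : Continuous F) (hφ : Continuous φ) :
    Measurable (linearVariation F φ) :=
  (measurable_fderiv_apply hF).add (hφ.measurable.mul (measurable_fderiv_apply_const ℝ F _))

theorem linearVariation_eq_zero {F φ : ℝ × ℝ → ℝ} {p : ℝ × ℝ} (hp : p ∉ tsupport φ) :
    linearVariation F φ p = 0 := by
  have h1 : fderiv ℝ φ p = 0 :=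
    image_eq_zero_of_notMem_tsupport fun h => hp (tsupport_fderiv_subset ℝ h)
  rw [linearVariation, h1, image_eq_zero_of_notMem_tsupport hp]
  simp

/-- The Euler-Lagrange equation of a stationary graph, tested with smooth functions. -/
theorem IsStationaryGraph.integral_eq_zero {Ω : Set (ℝ × ℝ)} {f : ℝ × ℝ → ℝ} (hΩ : IsOpen Ω)
    (hf : LocallyLipschitzOn Ω f) (hstat : IsStationaryGraph Ω f) {F : ℝ × ℝ → ℝ} {L : ℝ≥0}
    {M : ℝ} {W : Set (ℝ × ℝ)} (hF : LipschitzWith L F) (hM : ∀ p, |F p| ≤ M) (hW : IsOpen W)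
    (hWΩ : W ⊆ Ω) (hFf : EqOn F f W) {φ : ℝ × ℝ → ℝ} (hφ : IsTestFunction W φ) :
    ∫ p, areaSlope (nabla F p) * linearVariation F φ p = 0 := by
  obtain ⟨hφs, hφc, hφW⟩ := hφ
  have hφ1 : ContDiff ℝ 1 φ := hφs.of_le (by simp)
  obtain ⟨C, hC⟩ := hφ1.lipschitzWith_of_hasCompactSupport hφc one_ne_zero
  obtain ⟨B, hB⟩ := hφc.exists_bound_of_continuous hφs.continuous
  simp only [Real.norm_eq_abs] at hB
  set K := tsupport φ with hK
  have hKc : IsCompact K := hφc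
  have hKm : MeasurableSet K := (isClosed_tsupport φ).measurableSet
  have hfin : IsFiniteMeasure (volume.restrict K) := ⟨by
    rw [Measure.restrict_apply_univ]; exact hKc.measure_lt_top⟩
  let w : ℝ × ℝ → ℝ := fun p => φ p * fderiv ℝ φ p (0, 1)
  let q : ℝ → ℝ × ℝ → ℝ := fun ε p => nabla F p + ε * linearVariation F φ p + ε ^ 2 * w p
  have hw : ∀ p, |w p| ≤ B * C := fun p => by
    have : |fderiv ℝ φ p (0, 1)| ≤ C := by
      simpa [Prod.norm_def] using abs_fderiv_apply_le hC p (0, 1)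
    rw [abs_mul]
    exact mul_le_mul (hB p) this (abs_nonneg _) ((abs_nonneg _).trans (hB p))
  have hwm : Measurable w :=
    hφs.continuous.measurable.mul (measurable_fderiv_apply_const ℝ φ _)
  have hlm := measurable_linearVariation hF.continuous hφs.continuous
  have hnm : Measurable (nabla F) := measurable_fderiv_apply hF.continuous
  have hqm : ∀ ε, Measurable (q ε) := fun ε =>
    (hnm.add (hlm.const_mul ε)).add (hwm.const_mul (ε ^ 2))
  have harea : ∀ ε : ℝ, graphArea Ω (fun p => f p + ε * φ p) K =
      ∫ p in K, √(1 + q ε p ^ 2) := by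
    intro ε
    have hlip : LocallyLipschitzOn Ω fun p => f p + ε * φ p :=
      hf.add ((LocallyLipschitz.const ε).mul_real hC.locallyLipschitz).locallyLipschitzOn
    have h1 := ae_mono (Measure.restrict_mono (hφW.trans hWΩ) le_rfl)
      (intrinsicGradient_ae_eq hΩ hlip)
    refine integral_congr_ae ?_
    filter_upwards [h1, ae_restrict_of_ae hF.ae_differentiableAt, ae_restrict_mem hKm]
      with p hp hpd hpK
    have hFf' : (fun p => f p + ε * φ p) =ᶠ[𝓝 p] fun p => F p + ε * φ p := by
      filter_upwards [hW.mem_nhds (hφW hpK)] with x hx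
      rw [hFf hx]
    have hd : HasFDerivAt (fun p => F p + ε * φ p) (fderiv ℝ F p + ε • fderiv ℝ φ p) p :=
      hpd.hasFDerivAt.add
        (((hφs.differentiable (by simp)) p).hasFDerivAt.const_mul ε)
    have e : ((1 : ℝ), F p + ε * φ p) = (1, F p) + (ε * φ p) • ((0 : ℝ), (1 : ℝ)) := by simp
    have : intrinsicGradient Ω (fun p => f p + ε * φ p) p = q ε p := by
      rw [hp, nabla, hFf'.fderiv_eq, hd.fderiv, ← hFf (hφW hpK), e, map_add, map_smul]
      simp only [q, nabla, linearVariation, w, add_apply,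
        smul_apply, smul_eq_mul]
      ring
    rw [this]
  have hder : HasDerivAt (fun ε : ℝ => graphArea Ω (fun p => f p + ε * φ p) K) 0 0 :=
    hstat φ ⟨hφs, hφc, hφW.trans hWΩ⟩
  simp only [harea] at hder
  have hlin := abs_linearVariation_le hF hM hC hB
  have key := hasDerivAt_integral_of_dominated_loc_of_lip (μ := volume.restrict K)
    (F := fun ε p => √(1 + q ε p ^ 2)) (x₀ := (0 : ℝ)) (s := Metric.ball 0 1)
    (F' := fun p => areaSlope (nabla F p) * linearVariation F φ p)
    (bound := fun p => |linearVariation F φ p| + 2 * |w p|)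
    (Metric.ball_mem_nhds _ one_pos)
    (Eventually.of_forall fun ε => (by
      exact ((hqm ε).pow_const 2 |>.const_add 1).sqrt.aestronglyMeasurable)) ?_ ?_ ?_ ?_ ?_
  · have := hder.unique key.2
    rw [this]
    refine (setIntegral_eq_integral_of_forall_compl_eq_zero fun p hp => ?_).symm
    rw [linearVariation_eq_zero hp, mul_zero]
  · refine Integrable.of_bound ((hqm 0).pow_const 2 |>.const_add 1).sqrt.aestronglyMeasurable
      (1 + L * (1 + M)) (Eventually.of_forall fun p => ?_)
    have h1 := lipschitzWith_sqrt_one_add_sq.dist_le_mul (q 0 p) 0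
    have h2 := abs_nabla_le hF hM p
    have h3 : q 0 p = nabla F p := by simp [q]
    rw [h3] at h1 ⊢
    simp only [NNReal.coe_one, one_mul, Real.dist_eq, sub_zero] at h1
    rw [Real.norm_eq_abs]
    have h4 : √(1 + (0 : ℝ) ^ 2) = 1 := by simp
    rw [h4] at h1
    have := abs_sub_abs_le_abs_sub (√(1 + nabla F p ^ 2)) 1
    rw [abs_one] at this
    linarith
  · exact ((continuous_areaSlope.measurable.comp hnm).mul hlm).aestronglyMeasurable
  · refine Eventually.of_forall fun p => LipschitzOnWith.of_dist_le_mul fun ε hε ε' hε' => ?_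
    refine (lipschitzWith_sqrt_one_add_sq.dist_le_mul _ _).trans ?_
    rw [Metric.mem_ball, dist_zero_right, Real.norm_eq_abs] at hε hε'
    simp only [NNReal.coe_one, one_mul, Real.dist_eq, Real.coe_nnabs]
    rw [abs_of_nonneg (a := |linearVariation F φ p| + 2 * |w p|) (by positivity)]
    have e : q ε p - q ε' p = (linearVariation F φ p + (ε + ε') * w p) * (ε - ε') := by
      simp only [q]; ring
    rw [e, abs_mul]
    refine mul_le_mul_of_nonneg_right ((abs_add_le _ _).trans ?_) (abs_nonneg _)
    rw [abs_mul]
    gcongr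
    exact (abs_add_le _ _).trans (by linarith)
  · refine Integrable.of_bound (hlm.abs.add (hwm.abs.const_mul 2)).aestronglyMeasurable
      (C * (1 + M) + B * L + 2 * (B * C)) (Eventually.of_forall fun p => ?_)
    rw [Real.norm_eq_abs, abs_of_nonneg (by positivity)]
    linarith [hlin p, hw p]
  · refine Eventually.of_forall fun p => ?_
    have h1 : HasDerivAt (fun ε => q ε p) (linearVariation F φ p) 0 := by
      have := (((hasDerivAt_id (0 : ℝ)).mul_const (linearVariation F φ p)).const_add
        (nabla F p)).add (((hasDerivAt_pow 2 (0 : ℝ))).mul_const (w p))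
      exact this.congr_deriv (by simp)
    have h2 : q 0 p = nabla F p := by simp [q]
    have h3 := hasDerivAt_sqrt_one_add_sq (q 0 p)
    have := h3.comp (0 : ℝ) h1
    rw [h2] at this
    exact this

/-! ### Mollification of Lipschitz test functions -/

section Mollify

variable (ρ : ContDiffBump (0 : ℝ × ℝ)) (φ : ℝ × ℝ → ℝ)

/-- The convolution of `φ` with the normalized bump function `ρ`. -/
noncomputable def mollify (x : ℝ × ℝ) : ℝ := ∫ z, ρ.normed volume z * φ (x - z)

theorem mollify_eq_convolution :
    mollify ρ φ = (ρ.normed volume ⋆[ContinuousLinearMap.lsmul ℝ ℝ, volume] φ) := rfl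

variable {ρ φ} {C : ℝ≥0}

theorem integrable_mollify (hφ : LipschitzWith C φ) (x : ℝ × ℝ) :
    Integrable fun z => ρ.normed volume z * φ (x - z) := by
  have h1 : Continuous fun z => ρ.normed volume z * φ (x - z) :=
    (ρ.continuous_normed).mul (hφ.continuous.comp (by fun_prop))
  exact h1.integrable_of_hasCompactSupport ρ.hasCompactSupport_normed.mul_right

theorem contDiff_mollify (hφ : LipschitzWith C φ) : ContDiff ℝ ∞ (mollify ρ φ) := by
  rw [mollify_eq_convolution]
  exact ρ.hasCompactSupport_normed.contDiff_convolution_left _ ρ.contDiff_normed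
    hφ.continuous.locallyIntegrable

theorem abs_mollify_le {B : ℝ} (hB : ∀ p, |φ p| ≤ B) (x : ℝ × ℝ) : |mollify ρ φ x| ≤ B := by
  have h : ‖∫ z, ρ.normed volume z * φ (x - z)‖ ≤ ∫ z, ρ.normed volume z * B := by
    refine norm_integral_le_of_norm_le (ρ.integrable_normed.mul_const B)
      (Eventually.of_forall fun z => ?_)
    rw [norm_mul, Real.norm_eq_abs, abs_of_nonneg (ρ.nonneg_normed z)]
    exact mul_le_mul_of_nonneg_left (hB _) (ρ.nonneg_normed z)
  rwa [integral_mul_const, ρ.integral_normed, one_mul] at h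

theorem lipschitzWith_mollify (hφ : LipschitzWith C φ) : LipschitzWith C (mollify ρ φ) := by
  refine LipschitzWith.of_dist_le_mul fun x y => ?_
  rw [Real.dist_eq, mollify, mollify, ← integral_sub (integrable_mollify hφ x)
    (integrable_mollify hφ y)]
  have h : ‖∫ z, ρ.normed volume z * φ (x - z) - ρ.normed volume z * φ (y - z)‖ ≤
      ∫ z, ρ.normed volume z * (C * dist x y) := by
    refine norm_integral_le_of_norm_le (ρ.integrable_normed.mul_const _)
      (Eventually.of_forall fun z => ?_)
    rw [← mul_sub, norm_mul, Real.norm_eq_abs, abs_of_nonneg (ρ.nonneg_normed z)]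
    refine mul_le_mul_of_nonneg_left ?_ (ρ.nonneg_normed z)
    have := hφ.dist_le_mul (x - z) (y - z)
    rwa [dist_sub_right, dist_eq_norm] at this
  rwa [integral_mul_const, ρ.integral_normed, one_mul] at h

theorem support_mollify_subset {δ : ℝ} (hδ : ρ.rOut ≤ δ) :
    Function.support (mollify ρ φ) ⊆ Metric.cthickening δ (tsupport φ) := by
  intro x hx
  have : ∃ z, ρ.normed volume z * φ (x - z) ≠ 0 := by
    by_contra! h
    exact hx (by simp [mollify, h])
  obtain ⟨z, hz⟩ := this
  have h1 : z ∈ Metric.ball (0 : ℝ × ℝ) ρ.rOut := by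
    rw [← ρ.support_normed_eq (μ := volume)]
    exact left_ne_zero_of_mul hz
  refine Metric.mem_cthickening_of_dist_le x (x - z) δ _
    (subset_tsupport φ (right_ne_zero_of_mul hz)) ?_
  have : dist x (x - z) = ‖z‖ := by simp
  rw [this]
  exact (mem_ball_zero_iff.1 h1).le.trans hδ

/-- The derivative of a mollified Lipschitz function is the mollified derivative. -/
theorem lineDeriv_mollify (hφ : LipschitzWith C φ) (x v : ℝ × ℝ) :
    lineDeriv ℝ (mollify ρ φ) x v = mollify ρ (fun p => lineDeriv ℝ φ p v) x := by
  have hm : Measurable fun p => lineDeriv ℝ φ p v := measurable_lineDeriv hφ.continuous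
  have key := hasDerivAt_integral_of_dominated_loc_of_lip (μ := (volume : Measure (ℝ × ℝ)))
    (F := fun (t : ℝ) z => ρ.normed volume z * φ (x + t • v - z)) (x₀ := (0 : ℝ)) (s := univ)
    (F' := fun z => ρ.normed volume z * lineDeriv ℝ φ (x - z) v)
    (bound := fun z => ρ.normed volume z * (C * ‖v‖)) univ_mem
    (Eventually.of_forall fun t => (integrable_mollify hφ _).aestronglyMeasurable)
    (integrable_mollify hφ _)
    (ρ.continuous_normed.measurable.mul
      (hm.comp (measurable_const.sub measurable_id))).aestronglyMeasurable
    (Eventually.of_forall fun z => LipschitzOnWith.of_dist_le_mul fun t _ t' _ => ?_)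
    (ρ.integrable_normed.mul_const _) ?_
  · exact key.2.deriv
  · rw [Real.dist_eq, ← mul_sub, abs_mul, abs_of_nonneg (ρ.nonneg_normed z), Real.coe_nnabs,
      abs_mul, abs_of_nonneg (ρ.nonneg_normed z), mul_assoc]
    refine mul_le_mul_of_nonneg_left ?_ (ρ.nonneg_normed z)
    have h1 := hφ.dist_le_mul (x + t • v - z) (x + t' • v - z)
    have h2 : dist (x + t • v - z) (x + t' • v - z) = ‖v‖ * dist t t' := by
      rw [dist_sub_right, dist_add_left, dist_eq_norm, ← sub_smul, norm_smul, Real.dist_eq,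
        Real.norm_eq_abs, mul_comm]
    rw [h2, Real.dist_eq, ← mul_assoc] at h1
    rwa [abs_of_nonneg (a := (C : ℝ) * ‖v‖) (by positivity)]
  · have h1 := hφ.ae_lineDifferentiableAt (μ := (volume : Measure (ℝ × ℝ))) v
    have h2 := (Measure.measurePreserving_sub_left
      (volume : Measure (ℝ × ℝ)) x).quasiMeasurePreserving.ae h1
    filter_upwards [h2] with z hz
    have h3 := hz.hasLineDerivAt.const_mul (ρ.normed volume z)
    have e : ∀ t : ℝ, x - z + t • v = x + t • v - z := fun t => by abel
    simp only [e] at h3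
    exact h3

end Mollify

/-- The Euler-Lagrange equation holds for Lipschitz test functions once it holds for smooth
ones. -/
theorem integral_eq_zero_of_lipschitz {F : ℝ × ℝ → ℝ} {L : ℝ≥0} {M : ℝ} {W : Set (ℝ × ℝ)}
    (hF : LipschitzWith L F) (hM : ∀ p, |F p| ≤ M) (hW : IsOpen W)
    (hEL : ∀ φ, IsTestFunction W φ → ∫ p, areaSlope (nabla F p) * linearVariation F φ p = 0)
    {φ : ℝ × ℝ → ℝ} {C : ℝ≥0} (hφ : LipschitzWith C φ) (hc : HasCompactSupport φ)
    (hφW : tsupport φ ⊆ W) : ∫ p, areaSlope (nabla F p) * linearVariation F φ p = 0 := by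
  obtain ⟨δ, hδ, hδW⟩ := (show IsCompact (tsupport φ) from hc).exists_cthickening_subset_open hW hφW
  obtain ⟨B, hB⟩ := hc.exists_bound_of_continuous hφ.continuous
  simp only [Real.norm_eq_abs] at hB
  set K := Metric.cthickening δ (tsupport φ) with hK
  have hKc : IsCompact K := (show IsCompact (tsupport φ) from hc).cthickening
  have hKcl : IsClosed K := Metric.isClosed_cthickening
  let ρ : ℕ → ContDiffBump (0 : ℝ × ℝ) := fun n =>
    { rIn := δ / (n + 1) / 2
      rOut := δ / (n + 1)
      rIn_pos := by positivity
      rIn_lt_rOut := half_lt_self (by positivity) }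
  have hρ : Tendsto (fun n => (ρ n).rOut) atTop (𝓝 0) :=
    tendsto_const_div_atTop_nhds_zero_nat δ |>.comp (tendsto_add_atTop_nat 1) |>.congr
      fun n => by simp [ρ]
  have hρδ : ∀ n, (ρ n).rOut ≤ δ := fun n => by
    change δ / (n + 1) ≤ δ
    exact div_le_self hδ.le (by linarith [(Nat.cast_nonneg n : (0 : ℝ) ≤ n)])
  have hsupp : ∀ n, tsupport (mollify (ρ n) φ) ⊆ K := fun n =>
    closure_minimal (support_mollify_subset (hρδ n)) hKcl
  have hsmooth : ∀ n, ContDiff ℝ ∞ (mollify (ρ n) φ) := fun n => contDiff_mollify hφ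
  have htest : ∀ n, IsTestFunction W (mollify (ρ n) φ) := fun n =>
    ⟨hsmooth n, hKc.of_isClosed_subset (isClosed_tsupport _) (hsupp n), (hsupp n).trans hδW⟩
  have hlim0 : ∀ p, Tendsto (fun n => mollify (ρ n) φ p) atTop (𝓝 (φ p)) := fun p => by
    simp only [mollify_eq_convolution]
    exact ContDiffBump.convolution_tendsto_right_of_continuous hρ hφ.continuous p
  have hlim1 : ∀ v : ℝ × ℝ, ∀ᵐ p : ℝ × ℝ, Tendsto (fun n => fderiv ℝ (mollify (ρ n) φ) p v) atTop
      (𝓝 (fderiv ℝ φ p v)) := by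
    intro v
    have h1 := ContDiffBump.ae_convolution_tendsto_right_of_locallyIntegrable
      (μ := (volume : Measure (ℝ × ℝ))) (K := 2) hρ (Eventually.of_forall fun n => by
        change δ / (n + 1) ≤ 2 * (δ / (n + 1) / 2); linarith) (hφ.locallyIntegrable_lineDeriv v)
    filter_upwards [h1, hφ.ae_differentiableAt] with p hp hpd
    rw [← hpd.lineDeriv_eq_fderiv]
    refine hp.congr fun n => ?_
    rw [← (((hsmooth n).differentiable (by simp)) p).lineDeriv_eq_fderiv, lineDeriv_mollify hφ]
    rfl
  have hdecomp : ∀ (u : ℝ × ℝ → ℝ) (p : ℝ × ℝ), linearVariation F u p =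
      fderiv ℝ u p (1, 0) + F p * fderiv ℝ u p (0, 1) + u p * fderiv ℝ F p (0, 1) := by
    intro u p
    have : ((1 : ℝ), F p) = (1, 0) + F p • ((0 : ℝ), (1 : ℝ)) := by simp
    rw [linearVariation, this, map_add, map_smul, smul_eq_mul]
  have hnm : Measurable (nabla F) := measurable_fderiv_apply hF.continuous
  have hlim := tendsto_integral_of_dominated_convergence (μ := (volume : Measure (ℝ × ℝ)))
    (F := fun n p => areaSlope (nabla F p) * linearVariation F (mollify (ρ n) φ) p)
    (f := fun p => areaSlope (nabla F p) * linearVariation F φ p)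
    (K.indicator fun _ => C * (1 + M) + B * L)
    (fun n => ((continuous_areaSlope.measurable.comp hnm).mul
      (measurable_linearVariation hF.continuous (hsmooth n).continuous)).aestronglyMeasurable)
    ?_ ?_ ?_
  · simp only [hEL _ (htest _)] at hlim
    exact tendsto_nhds_unique hlim tendsto_const_nhds
  · rw [integrable_indicator_iff hKcl.measurableSet]
    exact integrableOn_const hKc.measure_lt_top.ne
  · refine fun n => Eventually.of_forall fun p => ?_
    by_cases hp : p ∈ K
    · rw [indicator_of_mem hp, norm_mul, Real.norm_eq_abs, Real.norm_eq_abs]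
      calc _ ≤ 1 * |linearVariation F (mollify (ρ n) φ) p| := by
            gcongr; exact abs_areaSlope_le _
        _ ≤ _ := by
            rw [one_mul]
            exact abs_linearVariation_le hF hM (lipschitzWith_mollify hφ)
              (abs_mollify_le hB) p
    · rw [indicator_of_notMem hp, linearVariation_eq_zero fun h => hp (hsupp n h)]
      simp
  · filter_upwards [hlim1 (1, 0), hlim1 (0, 1)] with p h1 h2
    simp only [hdecomp]
    exact ((h1.add (h2.const_mul (F p))).add ((hlim0 p).mul_const _)).const_mul _

/-! ### The flow of a bounded Lipschitz field -/

theorem lipschitzWith_slice {F : ℝ × ℝ → ℝ} {L : ℝ≥0} (hF : LipschitzWith L F) (s : ℝ) :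
    LipschitzWith L fun x => F (s, x) := by
  have := hF.comp (LipschitzWith.prodMk_left s)
  rwa [mul_one] at this

theorem exists_solution {F : ℝ × ℝ → ℝ} {L : ℝ≥0} {M : ℝ} (hF : LipschitzWith L F)
    (hM : ∀ p, |F p| ≤ M) (p : ℝ × ℝ) :
    ∃ x : ℝ → ℝ, x p.1 = p.2 ∧ ∀ s, HasDerivAt x (F (s, x s)) s := by
  have hM0 : 0 ≤ M := (abs_nonneg _).trans (hM 0)
  have hv := lipschitzWith_slice hF
  have hsol : ∀ n : ℕ, ∃ α : ℝ → ℝ, α p.1 = p.2 ∧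
      ∀ t ∈ Ioo (p.1 - (n + 1)) (p.1 + (n + 1)), HasDerivAt α (F (t, α t)) t := by
    intro n
    have hn : (0 : ℝ) ≤ n := n.cast_nonneg
    have hmem : p.1 ∈ Icc (p.1 - ((n : ℝ) + 1)) (p.1 + (n + 1)) := ⟨by linarith, by linarith⟩
    have hPL : IsPicardLindelof (fun s x => F (s, x)) ⟨p.1, hmem⟩ p.2
        (Real.toNNReal (M * (n + 1))) 0 (Real.toNNReal M) L :=
      { lipschitzOnWith := fun t _ => (hv t).lipschitzOnWith
        continuousOn := fun x _ => (hF.continuous.comp (by fun_prop)).continuousOn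
        norm_le := fun t _ x _ => by rw [Real.coe_toNNReal _ hM0]; exact hM _
        mul_max_le := by
          rw [Real.coe_toNNReal _ hM0, Real.coe_toNNReal _ (by positivity)]
          simp }
    obtain ⟨α, h0, h1⟩ := hPL.exists_eq_forall_mem_Icc_hasDerivWithinAt₀
    exact ⟨α, h0, fun t ht => (h1 t (Ioo_subset_Icc_self ht)).hasDerivAt (Icc_mem_nhds ht.1 ht.2)⟩
  choose α h0 h1 using hsol
  have hcomp : ∀ {m n : ℕ}, m ≤ n → ∀ t : ℝ, |t - p.1| < m + 1 → α m t = α n t := by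
    intro m n hmn t ht
    have hmn' : (m : ℝ) ≤ n := by exact_mod_cast hmn
    have hm0 : (0 : ℝ) ≤ m := m.cast_nonneg
    refine ODE_solution_unique_of_mem_Ioo (v := fun s x => F (s, x)) (K := L) (s := fun _ => univ)
      (fun t _ => (hv t).lipschitzOnWith) (t₀ := p.1) (a := p.1 - (m + 1)) (b := p.1 + (m + 1))
      ⟨by linarith, by linarith⟩ (fun t ht => ⟨h1 m t ht, mem_univ _⟩)
      (fun t ht => ⟨h1 n t ⟨by linarith [ht.1], by linarith [ht.2]⟩, mem_univ _⟩)
      (by rw [h0, h0]) ?_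
    have := abs_lt.1 ht
    exact ⟨by linarith, by linarith⟩
  refine ⟨fun t => α ⌈|t - p.1|⌉₊ t, h0 _, fun s => ?_⟩
  obtain ⟨N, hN⟩ := exists_nat_ge (|s - p.1| + 1)
  have hev : (fun t => α ⌈|t - p.1|⌉₊ t) =ᶠ[𝓝 s] α N := by
    have hnear : ∀ᶠ t in 𝓝 s, |t - p.1| < |s - p.1| + 1 := by
      have hc : Continuous fun t : ℝ => |t - p.1| := by fun_prop
      exact hc.continuousAt.eventually_lt_const (by linarith)
    filter_upwards [hnear] with t ht
    refine hcomp (Nat.ceil_le.2 (by linarith)) t ?_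
    linarith [Nat.le_ceil |t - p.1|]
  have hs : α ⌈|s - p.1|⌉₊ s = α N s := hev.self_of_nhds
  simp only [hs]
  refine HasDerivAt.congr_of_eventuallyEq (h1 N s ?_) hev
  have := abs_lt.1 (show |s - p.1| < N + 1 by linarith)
  exact ⟨by linarith, by linarith⟩

/-- `Φ p` is the solution of `x' = F (s, x)` with initial value `x p.1 = p.2`. -/
structure IsFlow (F : ℝ × ℝ → ℝ) (Φ : ℝ × ℝ → ℝ → ℝ) : Prop where
  init : ∀ p, Φ p p.1 = p.2
  deriv : ∀ p s, HasDerivAt (Φ p) (F (s, Φ p s)) s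

theorem exists_isFlow {F : ℝ × ℝ → ℝ} {L : ℝ≥0} {M : ℝ} (hF : LipschitzWith L F)
    (hM : ∀ p, |F p| ≤ M) : ∃ Φ, IsFlow F Φ := by
  choose Φ h0 h1 using exists_solution hF hM
  exact ⟨Φ, h0, h1⟩

theorem abs_sub_le_of_solutions_of_le {F : ℝ × ℝ → ℝ} {L : ℝ≥0} (hF : LipschitzWith L F)
    {x y : ℝ → ℝ} (hx : ∀ s, HasDerivAt x (F (s, x s)) s)
    (hy : ∀ s, HasDerivAt y (F (s, y s)) s) {r s : ℝ} (hrs : r ≤ s) :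
    |x s - y s| ≤ |x r - y r| * Real.exp (L * (s - r)) := by
  have hv := lipschitzWith_slice hF
  exact dist_le_of_trajectories_ODE hv (fun t _ => (hx t).continuousAt.continuousWithinAt)
    (fun t _ => (hx t).hasDerivWithinAt) (fun t _ => (hy t).continuousAt.continuousWithinAt)
    (fun t _ => (hy t).hasDerivWithinAt) le_rfl s ⟨hrs, le_rfl⟩

/-- Grönwall's inequality, forward and backward in time. -/
theorem abs_sub_le_of_solutions {F : ℝ × ℝ → ℝ} {L : ℝ≥0} (hF : LipschitzWith L F)
    {x y : ℝ → ℝ} (hx : ∀ s, HasDerivAt x (F (s, x s)) s)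
    (hy : ∀ s, HasDerivAt y (F (s, y s)) s) (r s : ℝ) :
    |x s - y s| ≤ |x r - y r| * Real.exp (L * |s - r|) := by
  rcases le_total r s with h | h
  · rw [abs_of_nonneg (sub_nonneg.2 h)]
    exact abs_sub_le_of_solutions_of_le hF hx hy h
  · -- reverse time
    have hG : LipschitzWith L fun p : ℝ × ℝ => -F (-p.1, p.2) := by
      refine LipschitzWith.of_dist_le_mul fun p q => ?_
      rw [dist_neg_neg]
      refine (hF.dist_le_mul _ _).trans (le_of_eq ?_)
      simp [Prod.dist_eq, dist_neg_neg]
    have hrev : ∀ {z : ℝ → ℝ}, (∀ s, HasDerivAt z (F (s, z s)) s) → ∀ s,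
        HasDerivAt (fun s => z (-s)) (-F (-s, z (-s))) s := fun hz s => by
      have := (hz (-s)).scomp s (hasDerivAt_neg s)
      rw [neg_one_smul] at this
      exact this
    have := abs_sub_le_of_solutions_of_le hG (hrev hx) (hrev hy) (neg_le_neg h)
    simp only [neg_neg] at this
    rwa [show -s - -r = |s - r| by rw [abs_of_nonpos (sub_nonpos.2 h)]; ring] at this

namespace IsFlow

variable {F : ℝ × ℝ → ℝ} {Φ : ℝ × ℝ → ℝ → ℝ} {L : ℝ≥0} {M : ℝ}

theorem eq_of_solution (hΦ : IsFlow F Φ) (hF : LipschitzWith L F) {x : ℝ → ℝ}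
    (hx : ∀ s, HasDerivAt x (F (s, x s)) s) (r : ℝ) : Φ (r, x r) = x := by
  ext s
  have := abs_sub_le_of_solutions hF (hΦ.deriv (r, x r)) hx r s
  rw [hΦ.init (r, x r)] at this
  simpa [sub_eq_zero] using this

theorem flow_flow (hΦ : IsFlow F Φ) (hF : LipschitzWith L F) (p : ℝ × ℝ) (r : ℝ) :
    Φ (r, Φ p r) = Φ p :=
  hΦ.eq_of_solution hF (hΦ.deriv p) r

theorem abs_sub_le_mul (hΦ : IsFlow F Φ) (hM : ∀ p, |F p| ≤ M) (p : ℝ × ℝ) (r s : ℝ) :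
    |Φ p r - Φ p s| ≤ M * |r - s| := by
  have := Convex.norm_image_sub_le_of_norm_hasDerivWithin_le (f := Φ p) (s := univ) (C := M)
    (x := s) (y := r) (fun t _ => (hΦ.deriv p t).hasDerivWithinAt) (fun t _ => hM _) convex_univ
    (mem_univ _) (mem_univ _)
  exact this

theorem abs_sub_le_mul_exp (hΦ : IsFlow F Φ) (hF : LipschitzWith L F) (hM : ∀ p, |F p| ≤ M)
    (p q : ℝ × ℝ) (r s : ℝ) : |Φ p r - Φ q s| ≤
      (|p.2 - q.2| + M * |p.1 - q.1|) * Real.exp (L * |r - p.1|) + M * |r - s| := by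
  have h1 := abs_sub_le_of_solutions hF (hΦ.deriv p) (hΦ.deriv q) p.1 r
  have h2 : |Φ p p.1 - Φ q p.1| ≤ |p.2 - q.2| + M * |p.1 - q.1| := by
    have h3 := hΦ.abs_sub_le_mul hM q q.1 p.1
    rw [hΦ.init, abs_sub_comm q.1] at h3
    rw [hΦ.init]
    exact (abs_sub_le _ q.2 _).trans (by linarith)
  have h3 := hΦ.abs_sub_le_mul hM q r s
  have h4 := mul_le_mul_of_nonneg_right h2 (Real.exp_pos (L * |r - p.1|)).le
  linarith [abs_sub_le (Φ p r) (Φ q r) (Φ q s)]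

theorem locallyLipschitz (hΦ : IsFlow F Φ) (hF : LipschitzWith L F) (hM : ∀ p, |F p| ≤ M) :
    LocallyLipschitz fun z : (ℝ × ℝ) × ℝ => Φ z.1 z.2 := by
  intro z
  have hM0 : 0 ≤ M := (abs_nonneg _).trans (hM 0)
  set R : ℝ := |z.2 - z.1.1| + 2 with hR
  set E : ℝ := Real.exp (L * R) with hE
  have hE0 : 0 < E := Real.exp_pos _
  refine ⟨Real.toNNReal ((1 + M) * E + M), Metric.ball z 1, Metric.ball_mem_nhds z one_pos,
    LipschitzOnWith.of_dist_le_mul fun x hx y hy => ?_⟩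
  rw [Real.coe_toNNReal _ (by positivity), Real.dist_eq]
  have h1 : |x.1.2 - y.1.2| ≤ dist x y :=
    (le_max_right (dist x.1.1 y.1.1) (dist x.1.2 y.1.2)).trans (le_max_left _ (dist x.2 y.2))
  have h2 : |x.1.1 - y.1.1| ≤ dist x y :=
    (le_max_left (dist x.1.1 y.1.1) (dist x.1.2 y.1.2)).trans (le_max_left _ (dist x.2 y.2))
  have h3 : |x.2 - y.2| ≤ dist x y := le_max_right _ _
  have h4 : |x.1.1 - z.1.1| < 1 := lt_of_le_of_lt
    ((le_max_left (dist x.1.1 z.1.1) (dist x.1.2 z.1.2)).trans (le_max_left _ (dist x.2 z.2))) hx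
  have h5 : |x.2 - z.2| < 1 := lt_of_le_of_lt (le_max_right (dist x.1 z.1) _) hx
  have h6 : |x.2 - x.1.1| ≤ R := by
    have a1 := abs_sub_le x.2 z.2 x.1.1
    have a2 := abs_sub_le z.2 z.1.1 x.1.1
    rw [abs_sub_comm z.1.1] at a2
    linarith
  have h7 : Real.exp (L * |x.2 - x.1.1|) ≤ E := by
    rw [hE]; gcongr
  refine (hΦ.abs_sub_le_mul_exp hF hM x.1 y.1 x.2 y.2).trans ?_
  calc _ ≤ (dist x y + M * dist x y) * E + M * dist x y := by gcongr
    _ = _ := by ring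

theorem flow_lt_flow (hΦ : IsFlow F Φ) (hF : LipschitzWith L F) {r τ τ' : ℝ} (h : τ < τ') (s : ℝ) :
    Φ (r, τ) s < Φ (r, τ') s := by
  by_contra! hcon
  have hc : Continuous fun s => Φ (r, τ') s - Φ (r, τ) s := by
    refine continuous_iff_continuousAt.2 fun s => ?_
    exact (hΦ.deriv _ s).continuousAt.sub (hΦ.deriv _ s).continuousAt
  have hmem : (0 : ℝ) ∈ uIcc (Φ (r, τ') r - Φ (r, τ) r) (Φ (r, τ') s - Φ (r, τ) s) := by
    rw [mem_uIcc, hΦ.init (r, τ'), hΦ.init (r, τ)]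
    right
    exact ⟨by linarith, by simp only; linarith⟩
  obtain ⟨t, -, ht⟩ := intermediate_value_uIcc hc.continuousOn hmem
  have h1 := abs_sub_le_of_solutions hF (hΦ.deriv (r, τ')) (hΦ.deriv (r, τ)) t r
  simp only at ht
  rw [ht, hΦ.init (r, τ'), hΦ.init (r, τ)] at h1
  have h2 : |τ' - τ| ≤ 0 := by simpa using h1
  exact absurd (abs_nonpos_iff.1 h2) (by linarith)

theorem mul_exp_neg_le_sub (hΦ : IsFlow F Φ) (hF : LipschitzWith L F) {r τ τ' : ℝ}
    (h : τ ≤ τ') (s : ℝ) :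
    (τ' - τ) * Real.exp (-(L * |s - r|)) ≤ Φ (r, τ') s - Φ (r, τ) s := by
  have h1 := abs_sub_le_of_solutions hF (hΦ.deriv (r, τ')) (hΦ.deriv (r, τ)) s r
  rw [hΦ.init (r, τ'), hΦ.init (r, τ), abs_sub_comm r s] at h1
  have h2 : Φ (r, τ) s ≤ Φ (r, τ') s := by
    rcases h.eq_or_lt with rfl | h
    · rfl
    · exact (hΦ.flow_lt_flow hF h s).le
  rw [abs_of_nonneg (sub_nonneg.2 h), abs_of_nonneg (sub_nonneg.2 h2)] at h1
  rw [Real.exp_neg, ← div_eq_mul_inv, div_le_iff₀ (Real.exp_pos _)]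
  exact h1

theorem sub_le_mul_exp (hΦ : IsFlow F Φ) (hF : LipschitzWith L F) {r τ τ' : ℝ}
    (h : τ ≤ τ') (s : ℝ) :
    Φ (r, τ') s - Φ (r, τ) s ≤ (τ' - τ) * Real.exp (L * |s - r|) := by
  have h1 := abs_sub_le_of_solutions hF (hΦ.deriv (r, τ')) (hΦ.deriv (r, τ)) r s
  rw [hΦ.init (r, τ'), hΦ.init (r, τ), abs_of_nonneg (sub_nonneg.2 h)] at h1
  exact (le_abs_self _).trans h1

end IsFlow

/-! ### Lagrangian changes of variables -/

theorem det_fst_prod (ℓ : ℝ × ℝ →L[ℝ] ℝ) :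
    ((ContinuousLinearMap.fst ℝ ℝ ℝ).prod ℓ).det = ℓ (0, 1) := by
  rw [ContinuousLinearMap.det, ← LinearMap.det_toMatrix (Module.Basis.finTwoProd ℝ),
    Matrix.det_fin_two]
  simp [LinearMap.toMatrix_apply]

section Lagrangian

variable {χ T : ℝ × ℝ → ℝ}

theorem lagrangianMap_leftInverse (h : ∀ s τ, T (s, χ (s, τ)) = τ) :
    Function.LeftInverse (lagrangianMap T) (lagrangianMap χ) := fun p =>
  Prod.ext rfl (h p.1 p.2)

theorem locallyLipschitz_lagrangianMap (hχ : LocallyLipschitz χ) :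
    LocallyLipschitz (lagrangianMap χ) :=
  LipschitzWith.prod_fst.locallyLipschitz.prodMk hχ

/-- Lagrangian coordinates with a locally Lipschitz inverse pull null sets back to null sets. -/
theorem ae_lagrangianMap (hT : LocallyLipschitz T) (h : ∀ s τ, T (s, χ (s, τ)) = τ)
    {P : ℝ × ℝ → Prop} (hP : ∀ᵐ q, P q) : ∀ᵐ p, P (lagrangianMap χ p) := by
  rw [ae_iff] at hP ⊢
  refine measure_mono_null ?_ ((locallyLipschitz_lagrangianMap hT).volume_image_eq_zero hP)
  intro p hp
  exact ⟨lagrangianMap χ p, hp, lagrangianMap_leftInverse h p⟩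

theorem integral_comp_lagrangianMap (hχ : LocallyLipschitz χ)
    (h : ∀ s τ, T (s, χ (s, τ)) = τ) (h' : ∀ s t, χ (s, T (s, t)) = t) (H : ℝ × ℝ → ℝ) :
    ∫ q, H q = ∫ p, |fderiv ℝ χ p (0, 1)| * H (lagrangianMap χ p) := by
  set D := {p | DifferentiableAt ℝ χ p} with hD
  have hDm : MeasurableSet D := measurableSet_of_differentiableAt ℝ χ
  have hD0 : volume Dᶜ = 0 := ae_iff.1 hχ.ae_differentiableAt
  have hinj : Function.Injective (lagrangianMap χ) := (lagrangianMap_leftInverse h).injective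
  have himg : (lagrangianMap χ '' D)ᶜ = lagrangianMap χ '' Dᶜ :=
    (image_compl_eq ⟨hinj, (lagrangianMap_leftInverse h').surjective⟩).symm
  have hd : ∀ p ∈ D, HasFDerivWithinAt (lagrangianMap χ)
      ((ContinuousLinearMap.fst ℝ ℝ ℝ).prod (fderiv ℝ χ p)) D p := fun p hp =>
    (hasFDerivAt_fst.prodMk (DifferentiableAt.hasFDerivAt hp)).hasFDerivWithinAt
  have key := integral_image_eq_integral_abs_det_fderiv_smul (volume : Measure (ℝ × ℝ)) hDm hd
    hinj.injOn H
  have e1 : volume.restrict (lagrangianMap χ '' D) = volume := by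
    refine Measure.restrict_eq_self_of_ae_mem ?_
    rw [ae_iff]
    change volume (lagrangianMap χ '' D)ᶜ = 0
    rw [himg]
    exact (locallyLipschitz_lagrangianMap hχ).volume_image_eq_zero hD0
  have e2 : volume.restrict D = volume := Measure.restrict_eq_self_of_ae_mem (ae_iff.2 hD0)
  rw [e1, e2] at key
  simpa only [det_fst_prod, smul_eq_mul] using key

end Lagrangian

/-! ### The Euler-Lagrange equation in Lagrangian coordinates -/

/-- The vertical Lagrangian coordinate: `flowMap Φ r (s, τ)` is the value at time `s` of the
solution that starts from `τ` at time `r`. -/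
def flowMap (Φ : ℝ × ℝ → ℝ → ℝ) (r : ℝ) (p : ℝ × ℝ) : ℝ := Φ (r, p.2) p.1

/-- The label at time `r` of the solution through `p`. -/
def flowLabel (Φ : ℝ × ℝ → ℝ → ℝ) (r : ℝ) (p : ℝ × ℝ) : ℝ := Φ p r

namespace IsFlow

variable {F : ℝ × ℝ → ℝ} {Φ : ℝ × ℝ → ℝ → ℝ} {L : ℝ≥0} {M : ℝ}

theorem flowLabel_flowMap (hΦ : IsFlow F Φ) (hF : LipschitzWith L F) (r s τ : ℝ) :
    flowLabel Φ r (s, flowMap Φ r (s, τ)) = τ := by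
  rw [flowLabel, flowMap, hΦ.flow_flow hF, hΦ.init (r, τ)]

theorem flowMap_flowLabel (hΦ : IsFlow F Φ) (hF : LipschitzWith L F) (r s t : ℝ) :
    flowMap Φ r (s, flowLabel Φ r (s, t)) = t := by
  rw [flowLabel, flowMap, hΦ.flow_flow hF, hΦ.init (s, t)]

theorem locallyLipschitz_flowMap (hΦ : IsFlow F Φ) (hF : LipschitzWith L F)
    (hM : ∀ p, |F p| ≤ M) (r : ℝ) : LocallyLipschitz (flowMap Φ r) :=
  (hΦ.locallyLipschitz hF hM).comp
    (((LocallyLipschitz.const r).prodMk LipschitzWith.prod_snd.locallyLipschitz).prodMk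
      LipschitzWith.prod_fst.locallyLipschitz)

theorem locallyLipschitz_flowLabel (hΦ : IsFlow F Φ) (hF : LipschitzWith L F)
    (hM : ∀ p, |F p| ≤ M) (r : ℝ) : LocallyLipschitz (flowLabel Φ r) :=
  (hΦ.locallyLipschitz hF hM).comp (LocallyLipschitz.id.prodMk (LocallyLipschitz.const r))

theorem hasDerivAt_flowMap (hΦ : IsFlow F Φ) (r s τ : ℝ) :
    HasDerivAt (fun s => flowMap Φ r (s, τ)) (F (lagrangianMap (flowMap Φ r) (s, τ))) s :=
  hΦ.deriv (r, τ) s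

theorem hasDerivAt_comp_flowMap (hΦ : IsFlow F Φ) (r : ℝ) {u : ℝ × ℝ → ℝ} {p : ℝ × ℝ}
    (hu : DifferentiableAt ℝ u (lagrangianMap (flowMap Φ r) p)) :
    HasDerivAt (fun s => u (lagrangianMap (flowMap Φ r) (s, p.2)))
      (fderiv ℝ u (lagrangianMap (flowMap Φ r) p) (1, F (lagrangianMap (flowMap Φ r) p))) p.1 :=
  hu.hasFDerivAt.comp_hasDerivAt p.1 ((hasDerivAt_id p.1).prodMk (hΦ.hasDerivAt_flowMap r p.1 p.2))

/-- If a stationary graph is written in Lagrangian coordinates `Ψ (s, τ) = (s, χ (s, τ))`, then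
`A (∇^F F) ∘ Ψ` has zero weak derivative in `s`, where `A` is the derivative of the area integrand.
Formally this is the Euler-Lagrange equation tested with `(θ / ∂_τ χ) ∘ Ψ⁻¹`; as `∂_τ χ` is only
bounded, it is replaced by difference quotients of `χ` in `τ`. -/
theorem integral_areaSlope_mul_deriv_eq_zero (hΦ : IsFlow F Φ) (hF : LipschitzWith L F)
    (hM : ∀ p, |F p| ≤ M) {W : Set (ℝ × ℝ)}
    (hEL : ∀ (φ : ℝ × ℝ → ℝ) (C : ℝ≥0), LipschitzWith C φ → HasCompactSupport φ → tsupport φ ⊆ W →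
      ∫ p, areaSlope (nabla F p) * linearVariation F φ p = 0)
    {r : ℝ} {Q : Set (ℝ × ℝ)} (hQ : IsCompact Q) (hQW : MapsTo (lagrangianMap (flowMap Φ r)) Q W)
    {θ E : ℝ × ℝ → ℝ} (hθ : LocallyLipschitz θ) (hθQ : ∀ p, p ∉ Q → θ p = 0)
    (hEm : Measurable E) (hEQ : ∀ p, p ∉ Q → E p = 0) {CE : ℝ} (hE : ∀ p, |E p| ≤ CE)
    (hθE : ∀ᵐ p : ℝ × ℝ, HasDerivAt (fun s => θ (s, p.2)) (E p) p.1) :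
    ∫ p, areaSlope (nabla F (lagrangianMap (flowMap Φ r) p)) * E p = 0 := by
  set χ := flowMap Φ r with hχdef
  set T := flowLabel Φ r with hTdef
  have hχ : LocallyLipschitz χ := hΦ.locallyLipschitz_flowMap hF hM r
  have hT : LocallyLipschitz T := hΦ.locallyLipschitz_flowLabel hF hM r
  have hTχ : ∀ s τ, T (s, χ (s, τ)) = τ := hΦ.flowLabel_flowMap hF r
  have hχT : ∀ s t, χ (s, T (s, t)) = t := hΦ.flowMap_flowLabel hF r
  have hΨc : Continuous (lagrangianMap χ) := (locallyLipschitz_lagrangianMap hχ).continuous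
  -- the difference quotients of `χ` and of `F ∘ Ψ` in the second variable
  let D : ℝ → ℝ × ℝ → ℝ := fun δ p => (χ (p.1, p.2 + δ) - χ p) / δ
  let B : ℝ → ℝ × ℝ → ℝ := fun δ p =>
    (F (lagrangianMap χ (p.1, p.2 + δ)) - F (lagrangianMap χ p)) / δ
  have hD_ge : ∀ δ > 0, ∀ p : ℝ × ℝ, Real.exp (-(L * |p.1 - r|)) ≤ D δ p := fun δ hδ p => by
    have := hΦ.mul_exp_neg_le_sub hF (r := r) (show p.2 ≤ p.2 + δ by linarith) p.1
    rw [le_div_iff₀ hδ]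
    rw [add_sub_cancel_left, mul_comm] at this
    exact this
  have hD_le : ∀ δ > 0, ∀ p : ℝ × ℝ, D δ p ≤ Real.exp (L * |p.1 - r|) := fun δ hδ p => by
    have := hΦ.sub_le_mul_exp hF (r := r) (show p.2 ≤ p.2 + δ by linarith) p.1
    rw [div_le_iff₀ hδ]
    rw [add_sub_cancel_left, mul_comm] at this
    exact this
  have hD_pos : ∀ δ > 0, ∀ p : ℝ × ℝ, 0 < D δ p := fun δ hδ p =>
    (Real.exp_pos _).trans_le (hD_ge δ hδ p)
  have hB_le : ∀ δ > 0, ∀ p : ℝ × ℝ, |B δ p| ≤ L * D δ p := fun δ hδ p => by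
    have h1 := (lipschitzWith_slice hF p.1).dist_le_mul (χ (p.1, p.2 + δ)) (χ p)
    have h2 : 0 ≤ χ (p.1, p.2 + δ) - χ p := by
      have := mul_pos (hD_pos δ hδ p) hδ
      rw [div_mul_cancel₀ _ hδ.ne'] at this
      exact this.le
    rw [Real.dist_eq, Real.dist_eq, abs_of_nonneg h2] at h1
    rw [abs_div, abs_of_pos hδ, ← mul_div_assoc]
    gcongr
    exact h1
  have hDlip : ∀ δ, LocallyLipschitz (D δ) := fun δ => by
    have h1 : LocallyLipschitz fun p : ℝ × ℝ => χ (p.1, p.2 + δ) :=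
      hχ.comp (LipschitzWith.prod_fst.locallyLipschitz.prodMk
        (LipschitzWith.prod_snd.locallyLipschitz.add (LocallyLipschitz.const δ)))
    have h2 := (h1.sub hχ).mul_real (LocallyLipschitz.const δ⁻¹)
    simpa only [D, div_eq_mul_inv] using h2
  have hDder : ∀ δ, ∀ p : ℝ × ℝ, HasDerivAt (fun s => D δ (s, p.2)) (B δ p) p.1 := fun δ p =>
    ((hΦ.hasDerivAt_flowMap r p.1 (p.2 + δ)).sub (hΦ.hasDerivAt_flowMap r p.1 p.2)).div_const δ
  have hBc : ∀ δ, Continuous (B δ) := fun δ =>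
    ((hF.continuous.comp (hΨc.comp (by fun_prop : Continuous fun p : ℝ × ℝ => (p.1, p.2 + δ)))).sub
      (hF.continuous.comp hΨc)).div_const δ
  -- the Euler-Lagrange equation with the test function `(θ / D δ) ∘ Ψ⁻¹`
  let Ft : ℝ × ℝ → ℝ := fun p => fderiv ℝ F (lagrangianMap χ p) (0, 1)
  let J : ℝ × ℝ → ℝ := fun p => fderiv ℝ χ p (0, 1)
  let A : ℝ × ℝ → ℝ := fun p => areaSlope (nabla F (lagrangianMap χ p))
  let I : ℝ → ℝ × ℝ → ℝ := fun δ p => |J p| * (A p *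
    (E p / D δ p - θ p * B δ p / D δ p ^ 2 + θ p / D δ p * Ft p))
  have hI : ∀ δ > 0, ∫ p, I δ p = 0 := by
    intro δ hδ
    let ψ : ℝ × ℝ → ℝ := fun p => θ p / D δ p
    have hψ : LocallyLipschitz ψ := hθ.div_real (hDlip δ) fun p => (hD_pos δ hδ p).ne'
    let φ : ℝ × ℝ → ℝ := fun q => ψ (lagrangianMap T q)
    have hφ : LocallyLipschitz φ := hψ.comp (locallyLipschitz_lagrangianMap hT)
    have hφψ : ∀ p, φ (lagrangianMap χ p) = ψ p := fun p => by
      change ψ (lagrangianMap T (lagrangianMap χ p)) = ψ p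
      rw [lagrangianMap_leftInverse hTχ p]
    have hQ' : IsCompact (lagrangianMap χ '' Q) := hQ.image hΨc
    have hφ0 : ∀ q, q ∉ lagrangianMap χ '' Q → φ q = 0 := by
      intro q hq
      have : lagrangianMap T q ∉ Q := fun h =>
        hq ⟨_, h, lagrangianMap_leftInverse hχT q⟩
      change θ _ / _ = 0
      rw [hθQ _ this, zero_div]
    have hφc : HasCompactSupport φ := HasCompactSupport.intro hQ' hφ0
    have hφs : tsupport φ ⊆ lagrangianMap χ '' Q :=
      closure_minimal (fun q hq => by_contra fun h => hq (hφ0 q h)) hQ'.isClosed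
    obtain ⟨C, hC⟩ := hφ.exists_lipschitzWith_of_hasCompactSupport hφc
    have h0 := hEL φ C hC hφc (hφs.trans hQW.image_subset)
    rw [integral_comp_lagrangianMap hχ hTχ hχT] at h0
    rw [← h0]
    refine integral_congr_ae ?_
    filter_upwards [hθE, ae_lagrangianMap hT hTχ hφ.ae_differentiableAt] with p hp1 hp2
    have e1 := hΦ.hasDerivAt_comp_flowMap r hp2
    have e2 : HasDerivAt (fun s => ψ (s, p.2))
        ((E p * D δ p - θ p * B δ p) / D δ p ^ 2) p.1 :=
      hp1.div (hDder δ p) (hD_pos δ hδ p).ne'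
    have e3 : (fun s => φ (lagrangianMap (flowMap Φ r) (s, p.2))) = fun s => ψ (s, p.2) :=
      funext fun s => hφψ (s, p.2)
    rw [e3] at e1
    have e4 := e1.unique e2
    have hDp := (hD_pos δ hδ p).ne'
    change |J p| * (A p * _) = |J p| * (A p * _)
    rw [linearVariation, e4, hφψ p]
    change _ = |J p| * (A p * (_ + θ p / D δ p * Ft p))
    rw [sub_div, pow_two, mul_div_mul_right _ _ hDp]
  -- passage to the limit
  obtain ⟨R, hR⟩ : ∃ R : ℝ, ∀ p ∈ Q, |p.1 - r| ≤ R := by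
    obtain ⟨R, hR⟩ := hQ.exists_bound_of_continuousOn
      (f := fun p : ℝ × ℝ => p.1 - r) (by fun_prop)
    exact ⟨R, fun p hp => hR p hp⟩
  obtain ⟨Cθ, hCθ⟩ := hQ.exists_bound_of_continuousOn hθ.continuous.continuousOn
  simp only [Real.norm_eq_abs] at hCθ
  set K : ℝ := Real.exp (L * R) with hK
  have hK0 : 0 < K := Real.exp_pos _
  have hAm : Measurable A := continuous_areaSlope.measurable.comp
    ((measurable_fderiv_apply hF.continuous).comp hΨc.measurable)
  have hJm : Measurable J := measurable_fderiv_apply_const ℝ χ _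
  have hFtm : Measurable Ft := (measurable_fderiv_apply_const ℝ F _).comp hΨc.measurable
  let δ : ℕ → ℝ := fun n => 1 / ((n : ℝ) + 1)
  have hδ : ∀ n, 0 < δ n := fun n => by positivity
  have hδlim : Tendsto δ atTop (𝓝[≠] 0) := tendsto_nhdsWithin_iff.2
    ⟨tendsto_one_div_add_atTop_nhds_zero_nat, Eventually.of_forall fun n => (hδ n).ne'⟩
  have hJder : ∀ p, DifferentiableAt ℝ χ p → HasDerivAt (fun t => χ (p.1, p.2 + t)) (J p) 0 := by
    intro p hp
    have := hp.hasFDerivAt.hasLineDerivAt (0, 1)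
    have e : ∀ t : ℝ, p + t • ((0 : ℝ), (1 : ℝ)) = (p.1, p.2 + t) := fun t =>
      Prod.ext (by simp) (by simp)
    simpa only [HasLineDerivAt, e] using this
  have hDlim : ∀ᵐ p : ℝ × ℝ, Tendsto (fun n => D (δ n) p) atTop (𝓝 (J p)) := by
    filter_upwards [hχ.ae_differentiableAt] with p hp
    have h1 := hJder p hp
    have h2 := (hasDerivAt_iff_tendsto_slope_zero.1 h1).comp hδlim
    refine h2.congr fun n => ?_
    simp only [Function.comp, zero_add, add_zero, smul_eq_mul, D]
    rw [div_eq_inv_mul]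
  have hBlim : ∀ᵐ p : ℝ × ℝ, Tendsto (fun n => B (δ n) p) atTop (𝓝 (Ft p * J p)) := by
    filter_upwards [hχ.ae_differentiableAt, ae_lagrangianMap hT hTχ hF.ae_differentiableAt]
      with p hp hFp
    have h1 := hJder p hp
    have h3 : HasFDerivAt F (fderiv ℝ F (lagrangianMap χ p)) (p.1, χ (p.1, p.2 + 0)) := by
      rw [add_zero]; exact hFp.hasFDerivAt
    have h2 : HasDerivAt (fun t => F (lagrangianMap χ (p.1, p.2 + t))) (Ft p * J p) 0 := by
      have := h3.comp_hasDerivAt (0 : ℝ) ((hasDerivAt_const (0 : ℝ) p.1).prodMk h1)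
      refine this.congr_deriv ?_
      have e : ((0 : ℝ), J p) = J p • ((0 : ℝ), (1 : ℝ)) := by simp
      rw [e, map_smul, smul_eq_mul, mul_comm]
    have h4 := (hasDerivAt_iff_tendsto_slope_zero.1 h2).comp hδlim
    refine h4.congr fun n => ?_
    simp only [Function.comp, zero_add, add_zero, smul_eq_mul, B]
    rw [div_eq_inv_mul]
  have hlim := tendsto_integral_of_dominated_convergence (μ := (volume : Measure (ℝ × ℝ)))
    (F := fun n => I (δ n)) (f := fun p => A p * E p)
    (Q.indicator fun _ => K * (1 * (CE * K + Cθ * (L * K) * K ^ 2 + Cθ * K * L)))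
    (fun n => ?_) ?_ ?_ ?_
  · simp only [hI _ (hδ _)] at hlim
    exact tendsto_nhds_unique hlim tendsto_const_nhds
  · have hDc := (hDlip (δ n)).continuous.measurable
    have hθm := hθ.continuous.measurable
    exact (hJm.abs.mul (hAm.mul (((hEm.div hDc).sub
      ((hθm.mul (hBc _).measurable).div (hDc.pow_const 2))).add
      ((hθm.div hDc).mul hFtm)))).aestronglyMeasurable
  · rw [integrable_indicator_iff hQ.measurableSet]
    exact integrableOn_const hQ.measure_lt_top.ne
  · intro n
    filter_upwards [hDlim] with p hp
    by_cases hpQ : p ∈ Q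
    · rw [indicator_of_mem hpQ, Real.norm_eq_abs]
      have hexp : Real.exp (L * |p.1 - r|) ≤ K := by
        rw [hK]; gcongr; exact hR p hpQ
      have hJ0 : 0 ≤ J p := ge_of_tendsto' hp fun n => (hD_pos _ (hδ n) p).le
      have hJK : |J p| ≤ K := by
        rw [abs_of_nonneg hJ0]
        exact le_of_tendsto' hp fun n => (hD_le _ (hδ n) p).trans hexp
      have hDn := hD_pos _ (hδ n) p
      have hDK : D (δ n) p ≤ K := (hD_le _ (hδ n) p).trans hexp
      have hDinv : (D (δ n) p)⁻¹ ≤ K := by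
        refine (inv_anti₀ (Real.exp_pos _) (hD_ge _ (hδ n) p)).trans ?_
        rw [Real.exp_neg, inv_inv]
        exact hexp
      have hBK : |B (δ n) p| ≤ L * K := (hB_le _ (hδ n) p).trans (by gcongr)
      have hFt : |Ft p| ≤ L := by
        simpa [Prod.norm_def] using abs_fderiv_apply_le hF (lagrangianMap χ p) (0, 1)
      have hCθp := hCθ p hpQ
      have hEp := hE p
      have hCE0 : 0 ≤ CE := (abs_nonneg _).trans hEp
      have hCθ0 : 0 ≤ Cθ := (abs_nonneg _).trans hCθp
      have t1 : |E p / D (δ n) p| ≤ CE * K := by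
        rw [div_eq_mul_inv, abs_mul, abs_of_pos (inv_pos.2 hDn)]
        gcongr
      have t2 : |θ p * B (δ n) p / D (δ n) p ^ 2| ≤ Cθ * (L * K) * K ^ 2 := by
        rw [div_eq_mul_inv, abs_mul, abs_mul, ← inv_pow, abs_of_pos (pow_pos (inv_pos.2 hDn) 2)]
        gcongr
      have t3 : |θ p / D (δ n) p * Ft p| ≤ Cθ * K * L := by
        rw [div_eq_mul_inv, abs_mul, abs_mul, abs_of_pos (inv_pos.2 hDn)]
        gcongr
      have t4 : |E p / D (δ n) p - θ p * B (δ n) p / D (δ n) p ^ 2 + θ p / D (δ n) p * Ft p| ≤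
          CE * K + Cθ * (L * K) * K ^ 2 + Cθ * K * L :=
        (abs_add_le _ _).trans (add_le_add ((abs_sub _ _).trans (add_le_add t1 t2)) t3)
      change |(|J p| * (A p * _))| ≤ _
      rw [abs_mul, abs_abs, abs_mul]
      gcongr
      exact abs_areaSlope_le _
    · rw [indicator_of_notMem hpQ]
      change ‖|J p| * (A p * (E p / _ - θ p * _ / _ + θ p / _ * _))‖ ≤ 0
      rw [hEQ p hpQ, hθQ p hpQ]
      simp
  · filter_upwards [hDlim, hBlim] with p h1 h2
    have hJ0 : 0 < J p := (Real.exp_pos _).trans_le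
      (ge_of_tendsto' h1 fun n => hD_ge _ (hδ n) p)
    have h3 := ((((tendsto_const_nhds (x := E p)).div h1 hJ0.ne').sub
      ((h2.const_mul (θ p)).div (h1.pow 2) (pow_ne_zero 2 hJ0.ne'))).add
      (((tendsto_const_nhds (x := θ p)).div h1 hJ0.ne').mul_const (Ft p))).const_mul (A p)
        |>.const_mul |J p|
    have e : |J p| * (A p * (E p / J p - θ p * (Ft p * J p) / J p ^ 2 + θ p / J p * Ft p)) =
        A p * E p := by
      rw [abs_of_pos hJ0]
      field_simp
      ring
    rw [e] at h3
    exact h3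

end IsFlow

/-! ### The function is affine along the integral curves -/

theorem hasLineDerivAt_of_hasDerivAt {u : ℝ × ℝ → ℝ} {c : ℝ} {p : ℝ × ℝ}
    (h : HasDerivAt (fun s => u (s, p.2)) c p.1) : HasLineDerivAt ℝ u c p (1, 0) := by
  have e : ∀ t : ℝ, p + t • ((1 : ℝ), (0 : ℝ)) = (p.1 + t, p.2) := fun t =>
    Prod.ext (by simp) (by simp)
  simp only [HasLineDerivAt, e]
  exact HasDerivAt.comp_const_add p.1 0 (by rwa [add_zero])

theorem ae_fst_ne (a : ℝ) : ∀ᵐ p : ℝ × ℝ, p.1 ≠ a := by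
  have : {p : ℝ × ℝ | ¬ p.1 ≠ a} = {a} ×ˢ univ := by ext p; simp
  rw [ae_iff, this, Measure.volume_eq_prod, Measure.prod_prod]
  simp

theorem integrable_of_bounded_of_compact {h : ℝ × ℝ → ℝ} {Q : Set (ℝ × ℝ)} {C : ℝ}
    (hm : Measurable h) (hQ : IsCompact Q) (hC : ∀ p, |h p| ≤ C) (h0 : ∀ p, p ∉ Q → h p = 0) :
    Integrable h := by
  rw [← integrableOn_iff_integrable_of_support_subset (s := Q)
    fun p hp => by_contra fun hpQ => hp (h0 p hpQ)]
  exact Measure.integrableOn_of_bounded hQ.measure_lt_top.ne hm.aestronglyMeasurable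
    (Eventually.of_forall hC)

/-- The slope of the affine function with the values of `F` at the times `y - r` and `y + r`, along
the solution with value `τ` at time `y`. -/
noncomputable def chordSlope (F : ℝ × ℝ → ℝ) (Φ : ℝ × ℝ → ℝ → ℝ) (y r τ : ℝ) : ℝ :=
  (F (lagrangianMap (flowMap Φ y) (y + r, τ)) - F (lagrangianMap (flowMap Φ y) (y - r, τ))) /
    (2 * r)

namespace IsFlow

variable {F : ℝ × ℝ → ℝ} {Φ : ℝ × ℝ → ℝ → ℝ} {L : ℝ≥0} {M : ℝ}

theorem locallyLipschitz_comp_flowMap (hΦ : IsFlow F Φ) (hF : LipschitzWith L F)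
    (hM : ∀ p, |F p| ≤ M) (y : ℝ) :
    LocallyLipschitz fun p => F (lagrangianMap (flowMap Φ y) p) :=
  hF.locallyLipschitz.comp (locallyLipschitz_lagrangianMap (hΦ.locallyLipschitz_flowMap hF hM y))

theorem locallyLipschitz_chordSlope (hΦ : IsFlow F Φ) (hF : LipschitzWith L F)
    (hM : ∀ p, |F p| ≤ M) (y r : ℝ) : LocallyLipschitz (chordSlope F Φ y r) := by
  have hb := hΦ.locallyLipschitz_comp_flowMap hF hM y
  have := ((hb.comp (LocallyLipschitz.prodMk_left (y + r))).sub
    (hb.comp (LocallyLipschitz.prodMk_left (y - r)))).mul_real (LocallyLipschitz.const (2 * r)⁻¹)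
  simpa only [chordSlope, div_eq_mul_inv] using! this

theorem abs_chordSlope_le (hM : ∀ p, |F p| ≤ M) {r : ℝ} (hr : 0 < r) (y τ : ℝ) :
    |chordSlope F Φ y r τ| ≤ M / r := by
  rw [chordSlope, abs_div, abs_of_pos (by positivity : 0 < 2 * r),
    div_le_div_iff₀ (by positivity) hr]
  have h1 := abs_sub (F (lagrangianMap (flowMap Φ y) (y + r, τ)))
    (F (lagrangianMap (flowMap Φ y) (y - r, τ)))
  have h2 := hM (lagrangianMap (flowMap Φ y) (y + r, τ))
  have h3 := hM (lagrangianMap (flowMap Φ y) (y - r, τ))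
  nlinarith

/-- For a stationary graph, `F` is affine in `s` along the curves `s ↦ Ψ (s, τ)`. The test function
is the difference `θ` between `F ∘ Ψ` and its affine interpolation in `s`, cut off in `τ`; as the
derivative `A` of the area integrand is strictly increasing, this forces `∂_s θ = 0`. -/
theorem comp_flowMap_eq_affine (hΦ : IsFlow F Φ) (hF : LipschitzWith L F)
    (hM : ∀ p, |F p| ≤ M) {W : Set (ℝ × ℝ)}
    (hEL : ∀ (φ : ℝ × ℝ → ℝ) (C : ℝ≥0), LipschitzWith C φ → HasCompactSupport φ → tsupport φ ⊆ W →
      ∫ p, areaSlope (nabla F p) * linearVariation F φ p = 0)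
    {y t r : ℝ} (hr : 0 < r)
    (hQW : MapsTo (lagrangianMap (flowMap Φ y)) (Metric.closedBall (y, t) r) W)
    {s τ : ℝ} (hs : s ∈ Icc (y - r) (y + r)) (hτ : |τ - t| < r) :
    F (lagrangianMap (flowMap Φ y) (s, τ)) = F (lagrangianMap (flowMap Φ y) (y - r, τ)) +
      chordSlope F Φ y r τ * (s - (y - r)) := by
  set b : ℝ × ℝ → ℝ := fun p => F (lagrangianMap (flowMap Φ y) p) with hbdef
  set k : ℝ → ℝ := chordSlope F Φ y r with hkdef
  set Q := Metric.closedBall (y, t) r with hQdef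
  have hQ : IsCompact Q := isCompact_closedBall _ _
  have hχ := hΦ.locallyLipschitz_flowMap hF hM y
  have hT := hΦ.locallyLipschitz_flowLabel hF hM y
  have hΨc := (locallyLipschitz_lagrangianMap hχ).continuous
  have hb : LocallyLipschitz b := hΦ.locallyLipschitz_comp_flowMap hF hM y
  have hk : LocallyLipschitz k := hΦ.locallyLipschitz_chordSlope hF hM y r
  have hk2 : ∀ τ, k τ * (2 * r) = b (y + r, τ) - b (y - r, τ) := fun τ =>
    div_mul_cancel₀ _ (by positivity)
  have hM0 : 0 ≤ M := (abs_nonneg _).trans (hM 0)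
  let cl : ℝ → ℝ := fun s => max (y - r) (min s (y + r))
  let ζ : ℝ → ℝ := fun τ => max 0 (r - |τ - t|)
  have hcl : LipschitzWith 1 cl := (LipschitzWith.id.min_const _).const_max _
  have hζ : LocallyLipschitz ζ := by
    have h1 : LipschitzWith 1 fun τ : ℝ => |τ - t| := LipschitzWith.of_dist_le_mul fun u v => by
      have := abs_abs_sub_abs_le_abs_sub (u - t) (v - t)
      simpa [Real.dist_eq] using this
    exact (((LipschitzWith.const r).sub h1).const_max 0).locallyLipschitz
  have hζ0 : ∀ τ, 0 ≤ ζ τ := fun τ => le_max_left _ _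
  have hζr : ∀ τ, ζ τ ≤ r := fun τ => max_le hr.le (by linarith [abs_nonneg (τ - t)])
  let θ : ℝ × ℝ → ℝ := fun p =>
    (b (cl p.1, p.2) - b (y - r, p.2) - k p.2 * (cl p.1 - (y - r))) * ζ p.2
  have hθ : LocallyLipschitz θ := by
    have hfst : LocallyLipschitz (Prod.fst : ℝ × ℝ → ℝ) := LipschitzWith.prod_fst.locallyLipschitz
    have hsnd : LocallyLipschitz (Prod.snd : ℝ × ℝ → ℝ) := LipschitzWith.prod_snd.locallyLipschitz
    have hc := hcl.locallyLipschitz.comp hfst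
    exact (((hb.comp (hc.prodMk hsnd)).sub
      (hb.comp ((LocallyLipschitz.const (y - r)).prodMk hsnd))).sub
      ((hk.comp hsnd).mul_real (hc.sub (LocallyLipschitz.const (y - r))))).mul_real (hζ.comp hsnd)
  have hθ1 : ∀ s τ, s ≤ y - r → θ (s, τ) = 0 := fun s τ h => by
    have : cl s = y - r := max_eq_left ((min_le_left _ _).trans h)
    simp only [θ, this]; ring
  have hθ2 : ∀ s τ, y + r ≤ s → θ (s, τ) = 0 := fun s τ h => by
    have : cl s = y + r := by
      simp only [cl]
      rw [min_eq_right h, max_eq_right (by linarith)]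
    have h2 := hk2 τ
    simp only [θ, this]
    rw [show y + r - (y - r) = 2 * r by ring, h2]; ring
  have hcl' : ∀ s ∈ Icc (y - r) (y + r), cl s = s := fun s h => by
    simp only [cl]
    rw [min_eq_left h.2, max_eq_right h.1]
  have hQmem : ∀ p : ℝ × ℝ, p ∉ Q → p.1 < y - r ∨ y + r < p.1 ∨ ζ p.2 = 0 := by
    intro p hp
    by_contra! h
    have h3 : 0 < r - |p.2 - t| := by
      by_contra! hcon
      exact h.2.2 (max_eq_left hcon)
    apply hp
    rw [hQdef, Metric.mem_closedBall, Prod.dist_eq]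
    refine max_le ?_ (by rw [Real.dist_eq]; simp only; linarith)
    rw [Real.dist_eq, abs_le]
    exact ⟨by simp only; linarith [h.1], by simp only; linarith [h.2.1]⟩
  have hθQ : ∀ p, p ∉ Q → θ p = 0 := by
    intro p hp
    rcases hQmem p hp with h | h | h
    · exact hθ1 p.1 p.2 h.le
    · exact hθ2 p.1 p.2 h.le
    · simp only [θ, h, mul_zero]
  -- the derivative of `θ` in `s`
  let g : ℝ × ℝ → ℝ := fun p => nabla F (lagrangianMap (flowMap Φ y) p)
  let E : ℝ × ℝ → ℝ :=
    (Ioo (y - r) (y + r) ×ˢ univ).indicator fun p => (g p - k p.2) * ζ p.2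
  have hgm : Measurable g := (measurable_fderiv_apply hF.continuous).comp hΨc.measurable
  have hEm : Measurable E :=
    ((hgm.sub (hk.continuous.measurable.comp measurable_snd)).mul
      (hζ.continuous.measurable.comp measurable_snd)).indicator
      (measurableSet_Ioo.prod MeasurableSet.univ)
  have hEQ : ∀ p, p ∉ Q → E p = 0 := by
    intro p hp
    rcases hQmem p hp with h | h | h
    · exact indicator_of_notMem (fun h' => by linarith [h'.1.1]) _
    · exact indicator_of_notMem (fun h' => by linarith [h'.1.2]) _
    · simp only [E, indicator, h, mul_zero, ite_self]
  have hEb : ∀ p, |E p| ≤ (L * (1 + M) + M / r) * r := by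
    intro p
    by_cases hp : p ∈ Ioo (y - r) (y + r) ×ˢ (univ : Set ℝ)
    · simp only [E]
      rw [indicator_of_mem hp, abs_mul, abs_of_nonneg (hζ0 _)]
      have h1 : |g p - k p.2| ≤ L * (1 + M) + M / r := (abs_sub _ _).trans
        (add_le_add (abs_nabla_le hF hM _) (abs_chordSlope_le hM hr y p.2))
      exact mul_le_mul h1 (hζr _) (hζ0 _) ((abs_nonneg _).trans h1)
    · simp only [E]
      rw [indicator_of_notMem hp, abs_zero]
      positivity
  have hθE : ∀ᵐ p : ℝ × ℝ, HasDerivAt (fun s => θ (s, p.2)) (E p) p.1 := by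
    filter_upwards [ae_lagrangianMap hT (hΦ.flowLabel_flowMap hF y) hF.ae_differentiableAt,
      ae_fst_ne (y - r), ae_fst_ne (y + r)] with p hp h1 h2
    have hout : p ∉ Ioo (y - r) (y + r) ×ˢ (univ : Set ℝ) →
        (fun s => θ (s, p.2)) =ᶠ[𝓝 p.1] (fun _ => 0) →
          HasDerivAt (fun s => θ (s, p.2)) (E p) p.1 := by
      intro h3 h4
      simp only [E]
      rw [indicator_of_notMem h3]
      exact (hasDerivAt_const p.1 (0 : ℝ)).congr_of_eventuallyEq h4
    rcases lt_or_gt_of_ne h1 with h3 | h3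
    · refine hout (fun h' => by linarith [h'.1.1]) ?_
      filter_upwards [Iio_mem_nhds h3] with s hs using hθ1 s _ (le_of_lt hs)
    rcases lt_or_gt_of_ne h2 with h4 | h4
    · have hmem : p ∈ Ioo (y - r) (y + r) ×ˢ (univ : Set ℝ) := ⟨⟨h3, h4⟩, mem_univ _⟩
      simp only [E]
      rw [indicator_of_mem hmem]
      have e1 := hΦ.hasDerivAt_comp_flowMap y hp
      have e2 : HasDerivAt (fun s => (b (s, p.2) - b (y - r, p.2) - k p.2 * (s - (y - r))) * ζ p.2)
          ((g p - k p.2) * ζ p.2) p.1 := by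
        have := ((e1.sub_const (b (y - r, p.2))).sub
          (((hasDerivAt_id p.1).sub_const (y - r)).const_mul (k p.2))).mul_const (ζ p.2)
        rw [mul_one] at this
        exact this
      refine e2.congr_of_eventuallyEq ?_
      filter_upwards [Ioo_mem_nhds h3 h4] with s hs
      simp only [θ, hcl' s (Ioo_subset_Icc_self hs)]
    · refine hout (fun h' => by linarith [h'.1.2]) ?_
      filter_upwards [Ioi_mem_nhds h4] with s hs using hθ2 s _ (le_of_lt hs)
  have hθc : HasCompactSupport θ := HasCompactSupport.intro hQ hθQ
  have int1 : ∫ p, areaSlope (g p) * E p = 0 :=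
    hΦ.integral_areaSlope_mul_deriv_eq_zero hF hM hEL hQ hQW hθ hθQ hEm hEQ hEb hθE
  have int2 : ∫ p : ℝ × ℝ, areaSlope (k p.2) * E p = 0 := by
    have hA : LocallyLipschitz fun p : ℝ × ℝ => areaSlope (k p.2) :=
      contDiff_areaSlope.locallyLipschitz.comp
        (hk.comp LipschitzWith.prod_snd.locallyLipschitz)
    have hc : HasCompactSupport fun p : ℝ × ℝ => areaSlope (k p.2) * θ p := hθc.mul_left
    obtain ⟨C, hC⟩ := (hA.mul_real hθ).exists_lipschitzWith_of_hasCompactSupport hc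
    rw [← integral_lineDeriv_eq_zero hC hc (1, 0)]
    refine integral_congr_ae ?_
    filter_upwards [hθE] with p hp
    exact (hasLineDerivAt_of_hasDerivAt
      (u := fun p : ℝ × ℝ => areaSlope (k p.2) * θ p)
      (hp.const_mul (areaSlope (k p.2)))).lineDeriv.symm
  have hint : ∀ h : ℝ × ℝ → ℝ, Measurable h →
      Integrable fun p => areaSlope (h p) * E p := fun h hh => by
    refine integrable_of_bounded_of_compact ((continuous_areaSlope.measurable.comp hh).mul hEm) hQ
      (C := 1 * ((L * (1 + M) + M / r) * r)) (fun p => ?_) fun p hp => by rw [hEQ p hp, mul_zero]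
    rw [abs_mul]
    exact mul_le_mul (abs_areaSlope_le _) (hEb p) (abs_nonneg _) zero_le_one
  have hi1 := hint g hgm
  have hi2 := hint (fun p => k p.2) (hk.continuous.measurable.comp measurable_snd)
  have int3 : ∫ p : ℝ × ℝ, (areaSlope (g p) * E p - areaSlope (k p.2) * E p) = 0 := by
    rw [integral_sub hi1 hi2, int1, int2, sub_zero]
  have hnn : ∀ p : ℝ × ℝ, 0 ≤ areaSlope (g p) * E p - areaSlope (k p.2) * E p := by
    intro p
    rw [← sub_mul]
    by_cases hp : p ∈ Ioo (y - r) (y + r) ×ˢ (univ : Set ℝ)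
    · simp only [E]
      rw [indicator_of_mem hp, ← mul_assoc]
      refine mul_nonneg ?_ (hζ0 _)
      rcases le_total (g p) (k p.2) with h | h
      · exact mul_nonneg_of_nonpos_of_nonpos
          (sub_nonpos.2 (areaSlope_strictMono.monotone h)) (sub_nonpos.2 h)
      · exact mul_nonneg (sub_nonneg.2 (areaSlope_strictMono.monotone h)) (sub_nonneg.2 h)
    · simp only [E]
      rw [indicator_of_notMem hp, mul_zero]
  rw [integral_eq_zero_iff_of_nonneg hnn (hi1.sub hi2)] at int3
  have hE0 : ∀ᵐ p : ℝ × ℝ, E p = 0 := by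
    filter_upwards [int3] with p hp
    rw [Pi.zero_apply, ← sub_mul, mul_eq_zero] at hp
    rcases hp with hp | hp
    · have : g p = k p.2 := areaSlope_strictMono.injective (sub_eq_zero.1 hp)
      simp only [E, indicator, this, sub_self, zero_mul, ite_self]
    · exact hp
  obtain ⟨C, hC⟩ := hθ.exists_lipschitzWith_of_hasCompactSupport hθc
  have hzero := eq_zero_of_lineDeriv_ae_eq_zero hC hθc (by
    filter_upwards [hθE, hE0] with p h1 h2
    rw [h2] at h1
    exact hasLineDerivAt_of_hasDerivAt h1) (s, τ)
  have hζpos : ζ τ ≠ 0 := (lt_max_of_lt_right (by linarith : 0 < r - |τ - t|)).ne'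
  have := (mul_eq_zero.1 hzero).resolve_right hζpos
  simp only [hcl' s hs] at this
  change b (s, τ) = b (y - r, τ) + k τ * (s - (y - r))
  linarith

/-- Near each point of the open set where the graph is stationary, the derivative of `F` along the
flow is a locally Lipschitz function, and this function is constant along the flow. -/
theorem exists_deriv_along_flow (hΦ : IsFlow F Φ) (hF : LipschitzWith L F)
    (hM : ∀ p, |F p| ≤ M) {W : Set (ℝ × ℝ)} (hW : IsOpen W)
    (hEL : ∀ (φ : ℝ × ℝ → ℝ) (C : ℝ≥0), LipschitzWith C φ → HasCompactSupport φ → tsupport φ ⊆ W →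
      ∫ p, areaSlope (nabla F p) * linearVariation F φ p = 0) {p₀ : ℝ × ℝ} (hp₀ : p₀ ∈ W) :
    ∃ N ∈ 𝓝 p₀, ∃ κ : ℝ × ℝ → ℝ, LocallyLipschitz κ ∧ (∀ p s, κ (s, Φ p s) = κ p) ∧
      ∀ p ∈ N, HasDerivAt (fun s => F (s, Φ p s)) (κ p) p.1 := by
  obtain ⟨y, t⟩ := p₀
  have hχ := hΦ.locallyLipschitz_flowMap hF hM y
  have hT := hΦ.locallyLipschitz_flowLabel hF hM y
  have hΨc := (locallyLipschitz_lagrangianMap hχ).continuous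
  have hΨ0 : lagrangianMap (flowMap Φ y) (y, t) = (y, t) := Prod.ext rfl (hΦ.init (y, t))
  have hnhds : lagrangianMap (flowMap Φ y) ⁻¹' W ∈ 𝓝 (y, t) :=
    hΨc.continuousAt.preimage_mem_nhds (by rw [hΨ0]; exact hW.mem_nhds hp₀)
  obtain ⟨r, hr, hrW⟩ := Metric.nhds_basis_closedBall.mem_iff.1 hnhds
  refine ⟨{p | |p.1 - y| < r ∧ |flowLabel Φ y p - t| < r}, ?_,
    fun p => chordSlope F Φ y r (flowLabel Φ y p),
    (hΦ.locallyLipschitz_chordSlope hF hM y r).comp hT, fun p s => ?_, fun p hp => ?_⟩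
  · have hTc := hT.continuous
    refine (IsOpen.and (isOpen_lt (by fun_prop) continuous_const)
      (isOpen_lt (by fun_prop) continuous_const)).mem_nhds ?_
    have : flowLabel Φ y (y, t) = t := hΦ.init (y, t)
    simp [this, hr]
  · simp only [flowLabel]
    rw [hΦ.flow_flow hF]
  · have hlin : HasDerivAt (fun s => F (lagrangianMap (flowMap Φ y) (y - r, flowLabel Φ y p)) +
        chordSlope F Φ y r (flowLabel Φ y p) * (s - (y - r)))
        (chordSlope F Φ y r (flowLabel Φ y p)) p.1 := by
      simpa using (((hasDerivAt_id p.1).sub_const (y - r)).const_mul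
        (chordSlope F Φ y r (flowLabel Φ y p))).const_add
        (F (lagrangianMap (flowMap Φ y) (y - r, flowLabel Φ y p)))
    refine hlin.congr_of_eventuallyEq ?_
    have h1 := abs_lt.1 hp.1
    filter_upwards [Ioo_mem_nhds (show y - r < p.1 by linarith) (show p.1 < y + r by linarith)]
      with s hs
    rw [← hΦ.comp_flowMap_eq_affine hF hM hEL hr hrW (Ioo_subset_Icc_self hs) hp.2]
    simp only [lagrangianMap, flowMap, flowLabel]
    rw [hΦ.flow_flow hF]

end IsFlow

/-! ### Integral curves and the continuous representative of the intrinsic gradient -/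

/-- The representative of `∇^f f` given by the directional derivative of `f` at `p` in the
direction `(1, f p)`; unlike `nabla f p`, it makes sense where `f` is not differentiable. -/
noncomputable def tangentDeriv (f : ℝ × ℝ → ℝ) (p : ℝ × ℝ) : ℝ := lineDeriv ℝ f p (1, f p)

/-- For a Lipschitz function, the derivative along a curve depends only on the tangent vector. -/
theorem _root_.LipschitzWith.hasLineDerivAt_of_curve {F : ℝ × ℝ → ℝ} {L : ℝ≥0}
    (hF : LipschitzWith L F) {x : ℝ → ℝ} {p : ℝ × ℝ} {v κ : ℝ} (h0 : x p.1 = p.2)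
    (hx : HasDerivAt x v p.1) (hκ : HasDerivAt (fun s => F (s, x s)) κ p.1) :
    HasLineDerivAt ℝ F κ p (1, v) := by
  have h1 : HasDerivAt (fun t => x (p.1 + t)) v 0 :=
    HasDerivAt.comp_const_add p.1 0 (by rwa [add_zero])
  have h2 : HasDerivAt (fun t => F (p.1 + t, x (p.1 + t))) κ 0 :=
    HasDerivAt.comp_const_add (f := fun s => F (s, x s)) p.1 0 (by rwa [add_zero])
  have h3 : HasDerivAt (fun t => F (p.1 + t, p.2 + t * v) - F (p.1 + t, x (p.1 + t))) 0 0 := by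
    rw [hasDerivAt_iff_isLittleO] at h1 ⊢
    refine Asymptotics.IsBigO.trans_isLittleO ?_ h1
    refine Asymptotics.IsBigO.of_bound L (Eventually.of_forall fun t => ?_)
    have := (lipschitzWith_slice hF (p.1 + t)).dist_le_mul (p.2 + t * v) (x (p.1 + t))
    simp only [add_zero, h0, zero_mul, Prod.mk.eta, sub_self, sub_zero, mul_zero, smul_eq_mul,
      Real.norm_eq_abs, Real.dist_eq] at this ⊢
    rw [abs_sub_comm (p.2 + t * v)] at this
    rwa [sub_sub]
  have e : ∀ t : ℝ, p + t • ((1 : ℝ), v) = (p.1 + t, p.2 + t * v) := fun t =>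
    Prod.ext (by simp) (by simp)
  have h4 := h3.add h2
  rw [zero_add] at h4
  refine HasDerivAt.congr_of_eventuallyEq h4 (Eventually.of_forall fun t => ?_)
  simp only [e, Pi.add_apply, sub_add_cancel]

/-- Near every point of the domain of a stationary graph, `tangentDeriv f` is a Lipschitz
function that is constant along the flow of a Lipschitz extension of `f`. -/
theorem IsStationaryGraph.exists_local_flow {Ω : Set (ℝ × ℝ)} {f : ℝ × ℝ → ℝ} (hΩ : IsOpen Ω)
    (hf : LocallyLipschitzOn Ω f) (hstat : IsStationaryGraph Ω f) {p₀ : ℝ × ℝ} (hp₀ : p₀ ∈ Ω) :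
    ∃ (F : ℝ × ℝ → ℝ) (L : ℝ≥0) (Φ : ℝ × ℝ → ℝ → ℝ) (N : Set (ℝ × ℝ)) (κ : ℝ × ℝ → ℝ),
      LipschitzWith L F ∧ IsFlow F Φ ∧ IsOpen N ∧ p₀ ∈ N ∧ N ⊆ Ω ∧ EqOn F f N ∧
      LocallyLipschitz κ ∧ (∀ p s, κ (s, Φ p s) = κ p) ∧
      (∀ p ∈ N, HasDerivAt (fun s => F (s, Φ p s)) (κ p) p.1) ∧
      ∀ p ∈ N, tangentDeriv f p = κ p := by
  obtain ⟨F, L, M, W, hF, hM, hW, hpW, hWΩ, hFf⟩ :=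
    exists_lipschitz_extension hΩ hf (isCompact_singleton (x := p₀)) (singleton_subset_iff.2 hp₀)
  obtain ⟨Φ, hΦ⟩ := exists_isFlow hF hM
  have hEL : ∀ (φ : ℝ × ℝ → ℝ) (C : ℝ≥0), LipschitzWith C φ → HasCompactSupport φ →
      tsupport φ ⊆ W → ∫ p, areaSlope (nabla F p) * linearVariation F φ p = 0 :=
    fun φ C hφ hc hs => integral_eq_zero_of_lipschitz hF hM hW
      (fun ψ hψ => hstat.integral_eq_zero hΩ hf hF hM hW hWΩ hFf hψ) hφ hc hs
  obtain ⟨N, hN, κ, hκ, hκc, hκd⟩ :=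
    hΦ.exists_deriv_along_flow hF hM hW hEL (singleton_subset_iff.1 hpW)
  obtain ⟨N', hN'N, hN', hpN'⟩ := mem_nhds_iff.1 hN
  refine ⟨F, L, Φ, N' ∩ W, κ, hF, hΦ, hN'.inter hW, ⟨hpN', singleton_subset_iff.1 hpW⟩,
    inter_subset_right.trans hWΩ, hFf.mono inter_subset_right, hκ, hκc,
    fun p hp => hκd p (hN'N hp.1), fun p hp => ?_⟩
  have h1 : HasDerivAt (Φ p) (F p) p.1 := by
    have := hΦ.deriv p p.1
    rwa [hΦ.init p] at this
  have h2 := hF.hasLineDerivAt_of_curve (hΦ.init p) h1 (hκd p (hN'N hp.1))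
  have h3 : f =ᶠ[𝓝 p] F := by
    filter_upwards [hW.mem_nhds hp.2] with q hq using (hFf hq).symm
  rw [tangentDeriv, ← hFf hp.2, h3.lineDeriv_eq, h2.lineDeriv]

section

variable {Ω : Set (ℝ × ℝ)} {f : ℝ × ℝ → ℝ}

theorem IsStationaryGraph.locallyLipschitzOn_tangentDeriv (hstat : IsStationaryGraph Ω f)
    (hΩ : IsOpen Ω) (hf : LocallyLipschitzOn Ω f) : LocallyLipschitzOn Ω (tangentDeriv f) := by
  intro p hp
  obtain ⟨F, L, Φ, N, κ, -, -, hN, hpN, -, -, hκ, -, -, hκg⟩ := hstat.exists_local_flow hΩ hf hp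
  obtain ⟨C, t, ht, hC⟩ := hκ p
  refine ⟨C, N ∩ t, nhdsWithin_le_nhds (inter_mem (hN.mem_nhds hpN) ht), fun a ha b hb => ?_⟩
  rw [hκg a ha.1, hκg b hb.1]
  exact hC ha.2 hb.2

theorem isIntrinsicGradient_tangentDeriv (hΩ : IsOpen Ω) (hf : LocallyLipschitzOn Ω f) :
    IsIntrinsicGradient Ω f (tangentDeriv f) := by
  refine ⟨_, _, hasWeakDeriv_fderiv hΩ hf _, hasWeakDeriv_fderiv hΩ hf _, ?_⟩
  rw [Filter.EventuallyEq, ae_restrict_iff' hΩ.measurableSet]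
  filter_upwards [hf.ae_differentiableAt hΩ] with p hp hpΩ
  rw [← nabla_eq, tangentDeriv, (hp hpΩ).lineDeriv_eq_fderiv, nabla]

/-- The right derivatives of `tangentDeriv f` and of `f` along a solution of `x' = f (s, x)`. -/
theorem IsStationaryGraph.hasDerivWithinAt_solution (hstat : IsStationaryGraph Ω f)
    (hΩ : IsOpen Ω) (hf : LocallyLipschitzOn Ω f) {x : ℝ → ℝ} {a b : ℝ}
    (hxΩ : ∀ s ∈ Icc a b, (s, x s) ∈ Ω)
    (hx : ∀ s ∈ Icc a b, HasDerivWithinAt x (f (s, x s)) (Icc a b) s) {s₀ : ℝ}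
    (hs₀ : s₀ ∈ Ico a b) :
    HasDerivWithinAt (fun s => tangentDeriv f (s, x s)) 0 (Ici s₀) s₀ ∧
      HasDerivWithinAt (fun s => f (s, x s)) (tangentDeriv f (s₀, x s₀)) (Ici s₀) s₀ := by
  have hmem : s₀ ∈ Icc a b := Ico_subset_Icc_self hs₀
  obtain ⟨F, L, Φ, N, κ, hF, hΦ, hN, hpN, -, hFf, -, hκc, hκd, hκg⟩ :=
    hstat.exists_local_flow hΩ hf (hxΩ s₀ hmem)
  set p : ℝ × ℝ := (s₀, x s₀) with hp
  have hnear : ∃ u ∈ Ioc s₀ b, ∀ s ∈ Icc s₀ u, (s, x s) ∈ N := by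
    have hc : ContinuousWithinAt (fun s => (s, x s)) (Icc a b) s₀ :=
      continuousWithinAt_id.prodMk (hx s₀ hmem).continuousWithinAt
    have h1 : (fun s => (s, x s)) ⁻¹' N ∈ 𝓝[≥] s₀ := by
      have h2 := (hc.mono (Icc_subset_Icc_left hs₀.1)).preimage_mem_nhdsWithin (hN.mem_nhds hpN)
      rwa [nhdsWithin_Icc_eq_nhdsGE hs₀.2] at h2
    obtain ⟨u, hu, hus⟩ := (mem_nhdsGE_iff_exists_mem_Ioc_Ico_subset hs₀.2).1 h1
    refine ⟨(s₀ + u) / 2, ⟨by linarith [hu.1], by linarith [hu.1, hu.2]⟩, fun s hs => hus ?_⟩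
    exact ⟨hs.1, by linarith [hs.2, hu.1]⟩
  obtain ⟨u, hu, huN⟩ := hnear
  have hsub : Icc s₀ u ⊆ Icc a b := Icc_subset_Icc hs₀.1 hu.2
  have heq : EqOn x (Φ p) (Icc s₀ u) := by
    refine ODE_solution_unique (lipschitzWith_slice hF)
      (fun s hs => (hx s (hsub hs)).continuousWithinAt.mono hsub) (fun s hs => ?_)
      (fun s _ => (hΦ.deriv p s).continuousAt.continuousWithinAt)
      (fun s _ => (hΦ.deriv p s).hasDerivWithinAt) (hΦ.init p).symm
    have hs' := Ico_subset_Icc_self hs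
    rw [hFf (huN s hs')]
    refine (hx s (hsub hs')).mono_of_mem_nhdsWithin ?_
    have : Icc s b ∈ 𝓝[≥] s := Icc_mem_nhdsGE (hs.2.trans_le hu.2)
    exact mem_of_superset this (Icc_subset_Icc_left (hs₀.1.trans hs.1))
  have hev : Icc s₀ u ∈ 𝓝[≥] s₀ := Icc_mem_nhdsGE hu.1
  have hgp : tangentDeriv f p = κ p := hκg p hpN
  constructor
  · refine (hasDerivWithinAt_const s₀ (Ici s₀) (κ p)).congr_of_eventuallyEq ?_ ?_
    · filter_upwards [hev] with s hs
      rw [hκg _ (huN s hs), heq hs, hκc]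
    · exact hgp
  · rw [hgp]
    refine (hκd p hpN).hasDerivWithinAt.congr_of_eventuallyEq ?_ ?_
    · filter_upwards [hev] with s hs
      rw [← hFf (huN s hs), heq hs]
    · rw [← hFf hpN, hΦ.init p]

/-- Along a solution of `x' = f (s, x)` the representative of `∇^f f` is constant, `f` is affine
and `x` is quadratic. -/
theorem IsStationaryGraph.solution_eq (hstat : IsStationaryGraph Ω f)
    (hΩ : IsOpen Ω) (hf : LocallyLipschitzOn Ω f) {x : ℝ → ℝ} {a b : ℝ}
    (hxΩ : ∀ s ∈ Icc a b, (s, x s) ∈ Ω)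
    (hx : ∀ s ∈ Icc a b, HasDerivWithinAt x (f (s, x s)) (Icc a b) s) {s : ℝ} (hs : s ∈ Icc a b) :
    tangentDeriv f (s, x s) = tangentDeriv f (a, x a) ∧
      f (s, x s) = f (a, x a) + tangentDeriv f (a, x a) * (s - a) ∧
      x s = x a + f (a, x a) * (s - a) + tangentDeriv f (a, x a) * ((s - a) ^ 2 / 2) := by
  have hxc : ContinuousOn x (Icc a b) := fun s hs => (hx s hs).continuousWithinAt
  have hγc : ContinuousOn (fun s => (s, x s)) (Icc a b) := continuousOn_id.prodMk hxc
  have hg : ∀ s ∈ Icc a b, tangentDeriv f (s, x s) = tangentDeriv f (a, x a) :=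
    constant_of_has_deriv_right_zero
      ((hstat.locallyLipschitzOn_tangentDeriv hΩ hf).continuousOn.comp hγc hxΩ)
      fun s hs => (hstat.hasDerivWithinAt_solution hΩ hf hxΩ hx hs).1
  have hlin : ∀ s ∈ Icc a b,
      f (s, x s) = f (a, x a) + tangentDeriv f (a, x a) * (s - a) := by
    intro s hs
    have := constant_of_has_deriv_right_zero (a := a) (b := b)
      (f := fun s => f (s, x s) - tangentDeriv f (a, x a) * (s - a))
      ((hf.continuousOn.comp hγc hxΩ).sub (by fun_prop)) (fun s hs => by
        have h1 := (hstat.hasDerivWithinAt_solution hΩ hf hxΩ hx hs).2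
        rw [hg s (Ico_subset_Icc_self hs)] at h1
        have h2 := h1.sub (((hasDerivWithinAt_id s (Ici s)).sub_const a).const_mul
          (tangentDeriv f (a, x a)))
        rw [mul_one, sub_self] at h2
        exact h2) s hs
    simp only [sub_self, mul_zero, sub_zero] at this
    linarith
  refine ⟨hg s hs, hlin s hs, ?_⟩
  have := constant_of_has_deriv_right_zero (a := a) (b := b)
    (f := fun s => x s - f (a, x a) * (s - a) - tangentDeriv f (a, x a) * ((s - a) ^ 2 / 2))
    ((hxc.sub (by fun_prop)).sub (by fun_prop)) (fun s hs => by
      have h1 : HasDerivWithinAt x (f (s, x s)) (Ici s) s :=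
        (hx s (Ico_subset_Icc_self hs)).mono_of_mem_nhdsWithin
          (mem_of_superset (Icc_mem_nhdsGE hs.2) (Icc_subset_Icc_left hs.1))
      have h2 := (hasDerivWithinAt_id s (Ici s)).sub_const a
      have h3 := (h1.sub (h2.const_mul (f (a, x a)))).sub
        (((h2.pow 2).div_const 2).const_mul (tangentDeriv f (a, x a)))
      refine h3.congr_deriv ?_
      rw [hlin s (Ico_subset_Icc_self hs)]
      simp only [id, Nat.cast_ofNat]
      ring) s hs
  simp only [sub_self, mul_zero, sub_zero, ne_eq, OfNat.ofNat_ne_zero, not_false_eq_true, zero_pow,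
    zero_div] at this
  linarith

/-- An absolutely continuous integral curve of a continuous field is continuously
differentiable. -/
theorem IsNablaCurve.hasDerivWithinAt {γ : ℝ → ℝ × ℝ} {I : Set ℝ} (hγ : IsNablaCurve f γ I)
    (hf : ContinuousOn f Ω) (hγΩ : ∀ s ∈ I, γ s ∈ Ω) {a b : ℝ} (hab : a ≤ b) (hI : Icc a b ⊆ I) :
    ∀ s ∈ Icc a b, (γ s).1 = (γ a).1 + (s - a) ∧
      HasDerivWithinAt (fun s => (γ s).2) (f (γ s)) (Icc a b) s := by
  have hAC := hγ.1 a b hab hI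
  have hγc : ContinuousOn γ (Icc a b) := by simpa [uIcc_of_le hab] using hAC.continuousOn
  -- a continuous extension of `f ∘ γ` to the line
  let h : ℝ → ℝ := fun s => f (γ (projIcc a b hab s))
  have hh : Continuous h :=
    (hf.comp hγc fun s hs => hγΩ s (hI hs)).comp_continuous
      (continuous_subtype_val.comp continuous_projIcc) fun s => (projIcc a b hab s).2
  have hhγ : ∀ s ∈ Icc a b, h s = f (γ s) := fun s hs => by simp only [h, projIcc_of_mem hab hs]
  let H : ℝ → ℝ := fun s => ∫ u in a..s, h u
  have hH : ∀ s, HasDerivAt H (h s) s := fun s => hh.integral_hasStrictDerivAt a s |>.hasDerivAt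
  have hHC : ContDiff ℝ 1 fun s => (s, H s) := by
    refine contDiff_id.prodMk (contDiff_one_iff_deriv.2
      ⟨fun s => (hH s).differentiableAt, ?_⟩)
    rwa [funext fun s => (hH s).deriv]
  have hconst := AbsolutelyContinuousOnInterval.const_of_ae_hasDerivAt_zero
    (hAC.sub hHC.contDiffOn.absolutelyContinuousOnInterval) (by
      have h1 : ∀ᵐ s ∂(volume.restrict (Icc a b)), HasDerivAt γ ((1 : ℝ), f (γ s)) s :=
        ae_mono (Measure.restrict_mono hI le_rfl) hγ.2
      rw [ae_restrict_iff' measurableSet_Icc] at h1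
      filter_upwards [h1] with s hs hs'
      rw [uIcc_of_le hab] at hs'
      have h2 := (hs hs').sub ((hasDerivAt_id s).prodMk (hH s))
      rw [hhγ s hs', sub_self] at h2
      exact h2)
  obtain ⟨C, hC⟩ := hconst
  rw [uIcc_of_le hab] at hC
  have hC' : ∀ s ∈ Icc a b, γ s = C + (s, H s) := fun s hs => by
    rw [← hC s hs]; simp
  have ha : a ∈ Icc a b := ⟨le_rfl, hab⟩
  intro s hs
  refine ⟨by rw [hC' s hs, hC' a ha]; simp, ?_⟩
  rw [← hhγ s hs]
  refine ((hH s).const_add C.2).hasDerivWithinAt.congr (fun u hu => ?_) ?_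
  · rw [hC' u hu]; rfl
  · rw [hC' s hs]; rfl

theorem IsStationaryGraph.tangentDeriv_eq_of_isNablaCurve (hstat : IsStationaryGraph Ω f)
    (hΩ : IsOpen Ω) (hf : LocallyLipschitzOn Ω f) {γ : ℝ → ℝ × ℝ} {I : Set ℝ}
    (hI : I.OrdConnected) (hγΩ : ∀ s ∈ I, γ s ∈ Ω) (hγ : IsNablaCurve f γ I) {s s' : ℝ}
    (hs : s ∈ I) (hs' : s' ∈ I) : tangentDeriv f (γ s) = tangentDeriv f (γ s') := by
  wlog hss : s ≤ s' generalizing s s'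
  · exact (this hs' hs (le_of_not_ge hss)).symm
  have hsub : Icc s s' ⊆ I := hI.out hs hs'
  have hcurve := hγ.hasDerivWithinAt hf.continuousOn hγΩ hss hsub
  -- reparametrize by the first coordinate
  set c : ℝ := (γ s).1 - s with hc
  let x : ℝ → ℝ := fun u => (γ (u - c)).2
  have hmem : ∀ u ∈ Icc (s + c) (s' + c), u - c ∈ Icc s s' := fun u hu =>
    ⟨by linarith [hu.1], by linarith [hu.2]⟩
  have hx : ∀ u ∈ Icc (s + c) (s' + c), (u, x u) = γ (u - c) := fun u hu => by
    refine Prod.ext ?_ rfl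
    rw [(hcurve _ (hmem u hu)).1]
    simp only [hc]; ring
  have h := hstat.solution_eq hΩ hf (x := x) (a := s + c) (b := s' + c) (s := s' + c)
    (fun u hu => by rw [hx u hu]; exact hγΩ _ (hsub (hmem u hu)))
    (fun u hu => by
      rw [hx u hu]
      have h1 := (hcurve _ (hmem u hu)).2
      have h2 := h1.scomp u ((hasDerivWithinAt_id u (Icc (s + c) (s' + c))).sub_const c) hmem
      rw [one_smul] at h2
      exact h2) ⟨by linarith, le_rfl⟩
  have e1 := hx (s + c) ⟨le_rfl, by linarith⟩
  have e2 := hx (s' + c) ⟨by linarith, le_rfl⟩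
  rw [add_sub_cancel_right] at e1 e2
  rw [e1, e2] at h
  exact h.1.symm

end

theorem IsFlow.isNablaCurve {F f : ℝ × ℝ → ℝ} {Φ : ℝ × ℝ → ℝ → ℝ} (hΦ : IsFlow F Φ)
    (hF : Continuous F) (p : ℝ × ℝ) {I : Set ℝ} (hI : MeasurableSet I)
    (hFf : ∀ s ∈ I, F (s, Φ p s) = f (s, Φ p s)) : IsNablaCurve f (fun s => (s, Φ p s)) I := by
  have hc : Continuous (Φ p) := continuous_iff_continuousAt.2 fun s => (hΦ.deriv p s).continuousAt
  have hC1 : ContDiff ℝ 1 fun s => (s, Φ p s) := by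
    refine contDiff_id.prodMk (contDiff_one_iff_deriv.2
      ⟨fun s => (hΦ.deriv p s).differentiableAt, ?_⟩)
    rw [funext fun s => (hΦ.deriv p s).deriv]
    fun_prop
  refine ⟨fun a b _ _ => hC1.contDiffOn.absolutelyContinuousOnInterval,
    ae_restrict_of_forall_mem hI fun s hs => ?_⟩
  rw [← hFf s hs]
  exact (hasDerivAt_id s).prodMk (hΦ.deriv p s)

/-! ### Lagrangian homeomorphisms -/

theorem isOpen_openInterval (a b : EReal) : IsOpen (openInterval a b) :=
  isOpen_Ioo.preimage continuous_coe_real_ereal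

theorem ordConnected_openInterval (a b : EReal) : (openInterval a b).OrdConnected :=
  ⟨fun _ hx _ hy _ hz => ⟨hx.1.trans_le (EReal.coe_le_coe_iff.2 hz.1),
    (EReal.coe_le_coe_iff.2 hz.2).trans_lt hy.2⟩⟩

theorem exists_openInterval_eq {S : Set ℝ} (hS : S.OrdConnected)
    (hlt : ∀ x ∈ S, ∃ y ∈ S, y < x) (hgt : ∀ x ∈ S, ∃ y ∈ S, x < y) :
    ∃ a b : EReal, openInterval a b = S := by
  refine ⟨sInf ((↑) '' S), sSup ((↑) '' S), Subset.antisymm ?_ ?_⟩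
  · rintro x ⟨h1, h2⟩
    obtain ⟨_, ⟨y, hy, rfl⟩, hyx⟩ := sInf_lt_iff.1 h1
    obtain ⟨_, ⟨z, hz, rfl⟩, hxz⟩ := lt_sSup_iff.1 h2
    exact hS.out hy hz ⟨(EReal.coe_lt_coe_iff.1 hyx).le, (EReal.coe_lt_coe_iff.1 hxz).le⟩
  · intro x hx
    obtain ⟨y, hy, hyx⟩ := hlt x hx
    obtain ⟨z, hz, hxz⟩ := hgt x hx
    exact ⟨(sInf_le (mem_image_of_mem _ hy)).trans_lt (EReal.coe_lt_coe_iff.2 hyx),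
      (EReal.coe_lt_coe_iff.2 hxz).trans_le (le_sSup (mem_image_of_mem _ hz))⟩

theorem exists_lt_mem_of_isOpen {S : Set ℝ} (hS : IsOpen S) {x : ℝ} (hx : x ∈ S) :
    (∃ y ∈ S, y < x) ∧ ∃ y ∈ S, x < y := by
  obtain ⟨ε, hε, h⟩ := Metric.isOpen_iff.1 hS x hx
  constructor
  · refine ⟨x - ε / 2, h ?_, by linarith⟩
    rw [Metric.mem_ball, Real.dist_eq, abs_lt]; constructor <;> linarith
  · refine ⟨x + ε / 2, h ?_, by linarith⟩
    rw [Metric.mem_ball, Real.dist_eq, abs_lt]; constructor <;> linarith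

/-- A locally Lipschitz function has Lagrangian coordinates on every open set that is compactly
contained in its domain: the flow of a bounded Lipschitz extension provides them. -/
theorem exists_isLagrangianHomeo {Ω U : Set (ℝ × ℝ)} {f : ℝ × ℝ → ℝ} (hΩ : IsOpen Ω)
    (hf : LocallyLipschitzOn Ω f) (hU : IsOpen U) (hUc : IsCompact (closure U))
    (hUΩ : closure U ⊆ Ω) : ∃ (V : Set (ℝ × ℝ)) (χ : ℝ × ℝ → ℝ), IsLagrangianHomeo f V U χ := by
  obtain ⟨F, L, M, W, hF, hM, -, hUW, -, hFf⟩ := exists_lipschitz_extension hΩ hf hUc hUΩ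
  obtain ⟨Φ, hΦ⟩ := exists_isFlow hF hM
  have hχ := hΦ.locallyLipschitz_flowMap hF hM 0
  have hT := hΦ.locallyLipschitz_flowLabel hF hM 0
  have hΨ := locallyLipschitz_lagrangianMap hχ
  refine ⟨lagrangianMap (flowMap Φ 0) ⁻¹' U, flowMap Φ 0, ⟨hU,
    hf.continuousOn.mono (subset_closure.trans hUΩ), hU.preimage hΨ.continuous,
    hχ.continuous.continuousOn, ?_, ?_, ?_⟩, hΨ.locallyLipschitzOn, lagrangianMap (flowLabel Φ 0),
    fun p _ => lagrangianMap_leftInverse (hΦ.flowLabel_flowMap hF 0) p,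
    (locallyLipschitz_lagrangianMap hT).locallyLipschitzOn⟩
  · exact image_preimage_eq _
      (lagrangianMap_leftInverse (hΦ.flowMap_flowLabel hF 0)).surjective
  · intro s τ τ' _ _ h
    rcases h.eq_or_lt with rfl | h
    · rfl
    · exact (hΦ.flow_lt_flow hF h s).le
  · intro τ s₁ s₂ h
    exact hΦ.isNablaCurve hF.continuous (0, τ) measurableSet_Ioo
      fun s hs => hFf (hUW (subset_closure (h s hs)))

section

variable {Ω U V : Set (ℝ × ℝ)} {f χ : ℝ × ℝ → ℝ} {S J : Set ℝ}

/-- Each curve of a Lagrangian parameterization of a stationary graph is a parabola. -/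
theorem IsStationaryGraph.lagrangian_eq (hstat : IsStationaryGraph Ω f)
    (hΩ : IsOpen Ω) (hf : LocallyLipschitzOn Ω f) (hUΩ : U ⊆ Ω) (hχ : IsLagrangianParam f V U χ)
    (hS : IsOpen S) (hS' : S.OrdConnected) (hV : S ×ˢ J ⊆ V) {s r τ : ℝ} (hs : s ∈ S)
    (hr : r ∈ S) (hτ : τ ∈ J) :
    χ (s, τ) = tangentDeriv f (r, χ (r, τ)) * ((s - r) ^ 2 / 2) + f (r, χ (r, τ)) * (s - r) +
      χ (r, τ) := by
  set m := min s r with hm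
  set n := max s r with hn
  have hmS : m ∈ S := by rcases min_choice s r with h | h <;> rw [hm, h] <;> assumption
  have hnS : n ∈ S := by rcases max_choice s r with h | h <;> rw [hn, h] <;> assumption
  obtain ⟨a, haS, ha⟩ := (exists_lt_mem_of_isOpen hS hmS).1
  obtain ⟨b, hbS, hb⟩ := (exists_lt_mem_of_isOpen hS hnS).2
  have hab : Ioo a b ⊆ S := Ioo_subset_Icc_self.trans (hS'.out haS hbS)
  have hmn : m ≤ n := min_le_max
  have hsub : Icc m n ⊆ Ioo a b := fun u hu => ⟨ha.trans_le hu.1, hu.2.trans_lt hb⟩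
  have hγΩ : ∀ u ∈ Ioo a b, lagrangianMap χ (u, τ) ∈ Ω := fun u hu =>
    hUΩ (hχ.image_eq ▸ mem_image_of_mem _ (hV ⟨hab hu, hτ⟩))
  have hγ := (hχ.integralCurve τ a b fun u hu => hV ⟨hab hu, hτ⟩).hasDerivWithinAt
    hf.continuousOn hγΩ hmn hsub
  have key := fun u (hu : u ∈ Icc m n) => hstat.solution_eq hΩ hf (x := fun u => χ (u, τ))
    (fun u hu => hγΩ u (hsub hu)) (fun u hu => (hγ u hu).2) hu
  obtain ⟨-, -, h1⟩ := key s ⟨min_le_left _ _, le_max_left _ _⟩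
  obtain ⟨h2, h3, h4⟩ := key r ⟨min_le_right _ _, le_max_right _ _⟩
  rw [h2, h3]
  linear_combination h1 - h4

/-- In a product of intervals, a locally biLipschitz Lagrangian homeomorphism can be relabelled by
its values at a fixed time `r`. -/
theorem IsLagrangianHomeo.relabel (hχ : IsLagrangianHomeo f V U χ) (hS : IsOpen S)
    (hJ : IsOpen J) (hJ' : J.OrdConnected) (hV : S ×ˢ J ⊆ V) {r : ℝ} (hr : r ∈ S) :
    LocallyBiLipschitzOn J (fun τ => χ (r, τ)) ∧
    ∃ (σ₁ σ₂ : EReal) (ρ : ℝ → ℝ),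
      (fun τ => χ (r, τ)) '' J = openInterval σ₁ σ₂ ∧
      LocallyBiLipschitzOn (openInterval σ₁ σ₂) ρ ∧
      ρ '' openInterval σ₁ σ₂ = J ∧
      (∀ σ ∈ openInterval σ₁ σ₂, χ (r, ρ σ) = σ) ∧
      IsLagrangianHomeo f (S ×ˢ openInterval σ₁ σ₂) (lagrangianMap χ '' (S ×ˢ J))
        (fun p => χ (p.1, ρ p.2)) := by
  obtain ⟨hP, hΨ, G, hG, hGl⟩ := hχ
  set c : ℝ → ℝ := fun τ => χ (r, τ) with hc
  set ρ : ℝ → ℝ := fun σ => (G (r, σ)).2 with hρ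
  have hfst : LocallyLipschitz (Prod.fst : ℝ × ℝ → ℝ) := LipschitzWith.prod_fst.locallyLipschitz
  have hsnd : LocallyLipschitz (Prod.snd : ℝ × ℝ → ℝ) := LipschitzWith.prod_snd.locallyLipschitz
  have hρc : ∀ τ ∈ J, ρ (c τ) = τ := fun τ hτ => by
    have : G (lagrangianMap χ (r, τ)) = (r, τ) := hG (hV ⟨hr, hτ⟩)
    exact congrArg Prod.snd this
  have hcL : LocallyLipschitzOn J c :=
    hsnd.locallyLipschitzOn (s := univ) |>.comp_of_mapsTo
      (hΨ.comp_of_mapsTo ((LocallyLipschitz.prodMk_left r).locallyLipschitzOn (s := J))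
        fun τ hτ => hV ⟨hr, hτ⟩) (mapsTo_univ _ _)
  have hmapc : MapsTo (fun σ => (r, σ)) (c '' J) (lagrangianMap χ '' V) := by
    rintro _ ⟨τ, hτ, rfl⟩
    exact ⟨(r, τ), hV ⟨hr, hτ⟩, rfl⟩
  have hρL : LocallyLipschitzOn (c '' J) ρ :=
    hsnd.locallyLipschitzOn (s := univ) |>.comp_of_mapsTo
      (hGl.comp_of_mapsTo ((LocallyLipschitz.prodMk_left r).locallyLipschitzOn) hmapc)
      (mapsTo_univ _ _)
  have hρim : ρ '' (c '' J) = J := by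
    rw [image_image]
    exact (image_congr hρc).trans (image_id' J)
  have hinj : InjOn c J := fun τ hτ τ' hτ' h => by rw [← hρc τ hτ, h, hρc τ' hτ']
  have hmono : StrictMonoOn c J := fun τ hτ τ' hτ' h =>
    lt_of_le_of_ne (hP.mono r τ τ' (hV ⟨hr, hτ⟩) (hV ⟨hr, hτ'⟩) h.le)
      fun he => h.ne (hinj hτ hτ' he)
  obtain ⟨σ₁, σ₂, hσ⟩ := exists_openInterval_eq (S := c '' J)
    (hJ'.isPreconnected.image c hcL.continuousOn).ordConnected
    (by
      rintro _ ⟨τ, hτ, rfl⟩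
      obtain ⟨τ', hτ', h⟩ := (exists_lt_mem_of_isOpen hJ hτ).1
      exact ⟨c τ', mem_image_of_mem c hτ', hmono hτ' hτ h⟩)
    (by
      rintro _ ⟨τ, hτ, rfl⟩
      obtain ⟨τ', hτ', h⟩ := (exists_lt_mem_of_isOpen hJ hτ).2
      exact ⟨c τ', mem_image_of_mem c hτ', hmono hτ hτ' h⟩)
  refine ⟨⟨hcL, ρ, hρc, hρL⟩, σ₁, σ₂, ρ, hσ.symm, ?_⟩
  rw [hσ]
  have hcρ : ∀ σ ∈ c '' J, c (ρ σ) = σ := by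
    rintro _ ⟨τ, hτ, rfl⟩
    rw [hρc τ hτ]
  have hρJ : ∀ σ ∈ c '' J, ρ σ ∈ J := fun σ hσ => hρim ▸ mem_image_of_mem ρ hσ
  -- the new coordinates are the old ones, precomposed with `(s, σ) ↦ (s, ρ σ)`
  let R : ℝ × ℝ → ℝ × ℝ := fun p => (p.1, ρ p.2)
  have hRL : LocallyLipschitzOn (S ×ˢ (c '' J)) R :=
    hfst.locallyLipschitzOn.prodMk (hρL.comp_of_mapsTo hsnd.locallyLipschitzOn fun p hp => hp.2)
  have hRmap : MapsTo R (S ×ˢ (c '' J)) (S ×ˢ J) := fun p hp => ⟨hp.1, hρJ _ hp.2⟩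
  have hRim : R '' (S ×ˢ (c '' J)) = S ×ˢ J := by
    refine Subset.antisymm hRmap.image_subset fun p hp => ⟨(p.1, c p.2), ⟨hp.1, p.2, hp.2, rfl⟩, ?_⟩
    exact Prod.ext rfl (hρc p.2 hp.2)
  have hΨR : lagrangianMap (fun p => χ (p.1, ρ p.2)) = fun p => lagrangianMap χ (R p) := rfl
  have hΨRL : LocallyLipschitzOn (S ×ˢ (c '' J)) (lagrangianMap (fun p => χ (p.1, ρ p.2))) :=
    hΨ.comp_of_mapsTo hRL fun p hp => hV (hRmap hp)
  have hΨRim : lagrangianMap (fun p => χ (p.1, ρ p.2)) '' (S ×ˢ (c '' J)) =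
      lagrangianMap χ '' (S ×ˢ J) := by
    rw [hΨR, ← hRim, image_image]
  have hσopen : IsOpen (c '' J) := hσ ▸ isOpen_openInterval σ₁ σ₂
  have hsubU : lagrangianMap χ '' (S ×ˢ J) ⊆ U := hP.image_eq ▸ image_mono hV
  have hopen : IsOpen (lagrangianMap χ '' (S ×ˢ J)) := by
    have h1 : lagrangianMap χ '' (S ×ˢ J) = U ∩ G ⁻¹' (S ×ˢ J) := by
      refine Subset.antisymm (fun q hq => ⟨hsubU hq, ?_⟩) ?_
      · obtain ⟨p, hp, rfl⟩ := hq
        rw [mem_preimage, hG (hV hp)]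
        exact hp
      · rintro q ⟨hqU, hq⟩
        rw [← hP.image_eq] at hqU
        obtain ⟨p, hp, rfl⟩ := hqU
        rw [mem_preimage, hG hp] at hq
        exact mem_image_of_mem _ hq
    rw [h1]
    have hGc : ContinuousOn G U := hP.image_eq ▸ hGl.continuousOn
    exact hGc.isOpen_inter_preimage hP.isOpen_target (hS.prod hJ)
  refine ⟨⟨hρL, c, hcρ, by rwa [hρim]⟩, hρim, hcρ, ⟨hopen, hP.continuousOn_field.mono hsubU,
    hS.prod hσopen, continuous_snd.comp_continuousOn hΨRL.continuousOn, hΨRim, ?_, ?_⟩, hΨRL,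
    fun q => ((G q).1, c (G q).2), ?_, ?_⟩
  · intro s σ σ' h h' hle
    refine hP.mono s _ _ (hV ⟨h.1, hρJ σ h.2⟩) (hV ⟨h'.1, hρJ σ' h'.2⟩) ?_
    by_contra! hlt
    have := hmono (hρJ σ' h'.2) (hρJ σ h.2) hlt
    rw [hcρ σ h.2, hcρ σ' h'.2] at this
    exact absurd hle (not_le.2 this)
  · exact fun σ s₁ s₂ h => hP.integralCurve (ρ σ) s₁ s₂ fun s hs => hV (hRmap (h s hs))
  · intro p hp
    have : G (lagrangianMap χ (R p)) = R p := hG (hV (hRmap hp))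
    simp only [hΨR, this]
    exact Prod.ext rfl (hcρ p.2 hp.2)
  · rw [hΨRim]
    have hGl' : LocallyLipschitzOn (lagrangianMap χ '' (S ×ˢ J)) G := hGl.mono (image_mono hV)
    have hGmap : MapsTo (fun q => (G q).2) (lagrangianMap χ '' (S ×ˢ J)) J := by
      rintro _ ⟨p, hp, rfl⟩
      simp only [hG (hV hp)]
      exact hp.2
    exact (hfst.locallyLipschitzOn (s := univ) |>.comp_of_mapsTo hGl' (mapsTo_univ _ _)).prodMk
      (hcL.comp_of_mapsTo (hsnd.locallyLipschitzOn (s := univ) |>.comp_of_mapsTo hGl'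
        (mapsTo_univ _ _)) hGmap)

/-- A weak Lagrangian solution: the required curves are those of the local flow. -/
theorem IsStationaryGraph.isWeakLagrangianSolution (hstat : IsStationaryGraph Ω f)
    (hΩ : IsOpen Ω) (hf : LocallyLipschitzOn Ω f) : IsWeakLagrangianSolution Ω f := by
  refine ⟨tangentDeriv f, isIntrinsicGradient_tangentDeriv hΩ hf,
    (hstat.locallyLipschitzOn_tangentDeriv hΩ hf).continuousOn, fun p hp => ?_⟩
  obtain ⟨F, L, Φ, N, -, hF, hΦ, hN, hpN, hNΩ, hFf, -, -, -, -⟩ := hstat.exists_local_flow hΩ hf hp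
  have hc : Continuous fun s => (s, Φ p s) := continuous_id.prodMk
    (continuous_iff_continuousAt.2 fun s => (hΦ.deriv p s).continuousAt)
  have hp0 : (p.1, Φ p p.1) = p := Prod.ext rfl (hΦ.init p)
  obtain ⟨ε, hε, hεN⟩ := Metric.isOpen_iff.1 (hN.preimage hc) p.1
    (by rw [mem_preimage, hp0]; exact hpN)
  rw [Real.ball_eq_Ioo] at hεN
  have hmem : p.1 ∈ Ioo (p.1 - ε) (p.1 + ε) := ⟨by linarith, by linarith⟩
  have hγΩ : ∀ s ∈ Ioo (p.1 - ε) (p.1 + ε), (s, Φ p s) ∈ Ω := fun s hs => hNΩ (hεN hs)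
  have hγ : IsNablaCurve f (fun s => (s, Φ p s)) (Ioo (p.1 - ε) (p.1 + ε)) :=
    hΦ.isNablaCurve hF.continuous p measurableSet_Ioo fun s hs => hFf (hεN hs)
  refine ⟨fun s => (s, Φ p s), p.1 - ε, p.1 + ε, hγΩ, hγ, ⟨p.1, hmem, hp0⟩, fun s hs => ?_⟩
  have := hstat.tangentDeriv_eq_of_isNablaCurve hΩ hf ordConnected_Ioo hγΩ hγ hs hmem
  rwa [hp0] at this

end

end IntrinsicGraph

theorem theorem1p2 (Ω : Set (ℝ × ℝ)) (hΩ : IsOpen Ω) (f : ℝ × ℝ → ℝ)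
    (hf : LocallyLipschitzOn Ω f) (hstat : IsStationaryGraph Ω f) :
    ∃ g : ℝ × ℝ → ℝ,
      -- `g` is the representative of `∇^f f`, and it is locally Lipschitz
      IsIntrinsicGradient Ω f g ∧ LocallyLipschitzOn Ω g ∧
      -- it is constant along every integral curve of `∇^f`
      (∀ (I : Set ℝ) (γ : ℝ → ℝ × ℝ), I.OrdConnected → (∀ s ∈ I, γ s ∈ Ω) →
        IsNablaCurve f γ I → ∀ s ∈ I, ∀ s' ∈ I, g (γ s) = g (γ s')) ∧
      IsC1Intrinsic Ω f ∧ IsWeakLagrangianSolution Ω f ∧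
      -- Lagrangian coordinates on every open set compactly contained in `Ω`
      ∀ U : Set (ℝ × ℝ), IsOpen U → IsCompact (closure U) → closure U ⊆ Ω →
        (∃ (V : Set (ℝ × ℝ)) (χ : ℝ × ℝ → ℝ), IsLagrangianHomeo f V U χ) ∧
        ∀ (V : Set (ℝ × ℝ)) (χ : ℝ × ℝ → ℝ), IsLagrangianHomeo f V U χ →
          ∀ (s₁ s₂ τ₁ τ₂ : EReal), openInterval s₁ s₂ ×ˢ openInterval τ₁ τ₂ ⊆ V →
          ∀ ŝ ∈ openInterval s₁ s₂,
            ∃ a b c : ℝ → ℝ,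
              (∀ s ∈ openInterval s₁ s₂, ∀ τ ∈ openInterval τ₁ τ₂,
                χ (s, τ) = a τ * ((s - ŝ) ^ 2 / 2) + b τ * (s - ŝ) + c τ) ∧
              LocallyBiLipschitzOn (openInterval τ₁ τ₂) c ∧
              (∀ τ ∈ openInterval τ₁ τ₂, a τ = g (ŝ, c τ) ∧ b τ = f (ŝ, c τ)) ∧
              LocallyLipschitzOn (openInterval τ₁ τ₂) a ∧
              LocallyLipschitzOn (openInterval τ₁ τ₂) b ∧
              -- after a locally biLipschitz change `τ = ρ(σ)` one has `c(σ) = σ`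
              ∃ (σ₁ σ₂ : EReal) (ρ : ℝ → ℝ),
                LocallyBiLipschitzOn (openInterval σ₁ σ₂) ρ ∧
                ρ '' openInterval σ₁ σ₂ = openInterval τ₁ τ₂ ∧
                (∀ σ ∈ openInterval σ₁ σ₂, c (ρ σ) = σ) ∧
                IsLagrangianHomeo f (openInterval s₁ s₂ ×ˢ openInterval σ₁ σ₂)
                  (lagrangianMap χ '' (openInterval s₁ s₂ ×ˢ openInterval τ₁ τ₂))
                  (fun p => χ (p.1, ρ p.2)) ∧
                LocallyLipschitzOn (openInterval σ₁ σ₂) (fun σ => g (ŝ, σ)) ∧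
                LocallyLipschitzOn (openInterval σ₁ σ₂) (fun σ => f (ŝ, σ)) ∧
                ∀ s ∈ openInterval s₁ s₂, ∀ σ ∈ openInterval σ₁ σ₂,
                  χ (s, ρ σ) = g (ŝ, σ) * ((s - ŝ) ^ 2 / 2) + f (ŝ, σ) * (s - ŝ) + σ := by
  have hg := hstat.locallyLipschitzOn_tangentDeriv hΩ hf
  have hgrad := isIntrinsicGradient_tangentDeriv hΩ hf
  refine ⟨tangentDeriv f, hgrad, hg, fun I γ hI hγΩ hγ s hs s' hs' =>
    hstat.tangentDeriv_eq_of_isNablaCurve hΩ hf hI hγΩ hγ hs hs',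
    ⟨hf.continuousOn, tangentDeriv f, hgrad, hg.continuousOn⟩,
    hstat.isWeakLagrangianSolution hΩ hf, fun U hU hUc hUΩ =>
    ⟨exists_isLagrangianHomeo hΩ hf hU hUc hUΩ, fun V χ hχ s₁ s₂ τ₁ τ₂ hV ŝ hŝ => ?_⟩⟩
  have hUΩ' : U ⊆ Ω := subset_closure.trans hUΩ
  obtain ⟨hc, σ₁, σ₂, ρ, hσ, hρ, hρim, hcρ, hnew⟩ := hχ.relabel (isOpen_openInterval s₁ s₂)
    (isOpen_openInterval τ₁ τ₂) (ordConnected_openInterval τ₁ τ₂) hV hŝ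
  have hcΩ : MapsTo (fun τ => (ŝ, χ (ŝ, τ))) (openInterval τ₁ τ₂) Ω := fun τ hτ =>
    hUΩ' (hχ.1.image_eq ▸
      (⟨(ŝ, τ), hV ⟨hŝ, hτ⟩, rfl⟩ : (ŝ, χ (ŝ, τ)) ∈ lagrangianMap χ '' V))
  have hσΩ : MapsTo (fun σ => (ŝ, σ)) (openInterval σ₁ σ₂) Ω := fun σ h => by
    rw [← hσ] at h
    obtain ⟨τ, hτ, rfl⟩ := h
    exact hcΩ hτ
  have hcL : LocallyLipschitzOn (openInterval τ₁ τ₂) fun τ => (ŝ, χ (ŝ, τ)) :=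
    (LocallyLipschitz.const ŝ).locallyLipschitzOn.prodMk hc.1
  have hσL : LocallyLipschitzOn (openInterval σ₁ σ₂) fun σ => (ŝ, σ) :=
    (LocallyLipschitz.prodMk_left ŝ).locallyLipschitzOn
  have hquad : ∀ s ∈ openInterval s₁ s₂, ∀ τ ∈ openInterval τ₁ τ₂, _ := fun s hs τ hτ =>
    hstat.lagrangian_eq hΩ hf hUΩ' hχ.1 (isOpen_openInterval s₁ s₂)
      (ordConnected_openInterval s₁ s₂) hV hs hŝ hτ
  refine ⟨fun τ => tangentDeriv f (ŝ, χ (ŝ, τ)), fun τ => f (ŝ, χ (ŝ, τ)), fun τ => χ (ŝ, τ),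
    hquad, hc, fun τ _ => ⟨rfl, rfl⟩, hg.comp_of_mapsTo hcL hcΩ, hf.comp_of_mapsTo hcL hcΩ,
    σ₁, σ₂, ρ, hρ, hρim, hcρ, hnew, hg.comp_of_mapsTo hσL hσΩ, hf.comp_of_mapsTo hσL hσΩ,
    fun s hs σ h => ?_⟩
  have := hquad s hs (ρ σ) (hρim ▸ mem_image_of_mem ρ h)
  rwa [hcρ σ h] at this
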